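/- Let $L\ge 1$ and $n\ge 0$ be integers, let $\zeta=e^{i\pi/(L+4)}$, and put $$F_L(t)=\frac{1}{(L+4)^2}\sum_{\substack{1\le j<k\le L+3\\ j,k\text{ odd}}}\frac{(\zeta^k+\zeta^{-k}-\zeta^j-\zeta^{-j})^2(2+\zeta^j+\zeta^{-j})(2+\zeta^k+\zeta^{-k})}{1-(\zeta^j+\zeta^{-j}+\zeta^k+\zeta^{-k})\,t}.$$ Each of the following sets is finite, and its cardinality equals the coefficient of $t^n$ in the power series $F_L(t)$. (a) The set of standard cylindric tableaux of period $(4,L)$ with $n$ cells and inner shape $[0,0,0,0]$. Here a cylindric shape of period $(d,L)$ is a weakly decreasing sequence of integers $\lambda=(\lambda_i)_{i\in\mathbb Z}$ with $\lambda_i=\lambda_{i+d}+L$ for all $i$, written $[\lambda_1,\dots,\lambda_d]$; cells are the classes $\langle i,j\rangle$ of $(i,j)\in\mathbb Z^2$ modulo $\mathbb Z(-d,L)$; and for shapes $\mu,\lambda$ with $\mu_i\le\lambda_i$ for all $i$, a standard cylindric tableau with inner shape $\mu$ and outer shape $\lambda$ is a bijection $T$ from the set $Y_{\lambda/\mu}=\{\langle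 i,j\rangle:\mu_i<j\le\lambda_i\}$ to $\{1,\dots,|Y_{\lambda/\mu}|\}$ such that $T(\langle i,j\rangle)<T(\langle i+1,j\rangle)$ and $T(\langle i,j\rangle)<T(\langle i,j+1\rangle)$ whenever both cells lie in $Y_{\lambda/\mu}$. The outer shape is arbitrary, subject to $|Y_{\lambda/\mu}|=n$. (b) For any corner $c$ of $\Delta_{4,L}$, the set of $n$-step walks in $\mathcal D_{4,L}$ starting at $c$. Here $\Delta_{d,M}=\{x\in\mathbb N^d:x_1+\dots+x_d=M\}$; its corners are the points with one coordinate $M$ and all others $0$; and $\mathcal D_{d,M}$ is the directed graph on $\Delta_{d,M}$ with an edge from $x$ to $y$ if $y-x=e_{i+1}-e_i$ for some $i\in\{1,\dots,d\}$, where $e_1,\dots,e_d$ are the unit vectors and $e_{d+1}=e_1$ (for $d=1$ the only edge is a loop). (b$'$) For any corner $c$ of $\Delta_{L,4}$, the set of $n$-step walks in $\mathcal D_{L,4}$ starting at $c$. (c) The set of $n$-step walks in $\mathcal E_{4,L}$ starting at $1^40^L$. Here $\mathcal E_{d,L}$ is the directed graph of TASEP states: its vertices are the binary words $u_1\cdots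 u_{d+L}$ with exactly $d$ ones, with indices modulo $d+L$, and there is an edge from $u$ to $v$ if for some $r$ we have $u_{r-1}u_r=01$, $v_{r-1}v_r=10$ and $u_t=v_t$ for all $t\ne r-1,r$. (d) The set of $n$-step walks in $\mathcal N_{4,L}$ starting at the necklace $[1^40^L]$. Here $\mathcal N_{d,L}$ is the directed multigraph whose vertices are the classes $[u]$ of vertices of $\mathcal E_{d,L}$ up to cyclic rotation (necklaces), where the number of edges from $[u]$ to $[v]$ is the number of $\tilde v\in[v]$ such that $\mathcal E_{d,L}$ has an edge from $u$ to $\tilde v$; parallel edges are distinguished in walks. -/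

import Mathlib

namespace Cylindric

/-! ### Walks in directed graphs and multigraphs -/

/-- The `n`-step walks in a directed graph `G` starting at `u`, as sequences of vertices. -/
abbrev DiWalk {V : Type*} (G : Digraph V) (u : V) (n : ℕ) : Type _ :=
  {w : Fin (n + 1) → V // w 0 = u ∧ ∀ k : Fin n, G.Adj (w k.castSucc) (w k.succ)}

/-- A directed multigraph (loops allowed) with vertex set `V`, given by the number of edges
from one vertex to another. -/
structure DiMultigraph (V : Type*) where
  /-- the number of edges from the first vertex to the second -/
  mult : V → V → ℕ

/-- The `n`-step walks in a directed multigraph `G` starting at `u`: a sequence of vertices,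
and for each step the choice of one of the edges between the two successive vertices. -/
abbrev MultiWalk {V : Type*} (G : DiMultigraph V) (u : V) (n : ℕ) : Type _ :=
  Σ w : {w : Fin (n + 1) → V // w 0 = u},
    ∀ k : Fin n, Fin (G.mult (w.1 k.castSucc) (w.1 k.succ))

/-! ### Walks in simplices -/

/-- `Δ_{d,L}`: points of `ℕ^d` with coordinate sum `L`. -/
abbrev Simp (d L : ℕ) : Type := {x : Fin d → ℕ // ∑ i, x i = L}

/-- The step `s_i = e_{i+1} - e_i`, with indices taken cyclically. -/
def simpStep {d : ℕ} (i : Fin d) : Fin d → ℤ :=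
  Pi.single (finRotate d i) 1 - Pi.single i 1

/-- The directed graph on `Δ_{d,L}` with an edge from `x` to `y` when `y - x` is one of
the steps `s_i`. -/
def simpGraph (d L : ℕ) : Digraph (Simp d L) where
  Adj x y := ∃ i : Fin d, (fun j => (y.1 j : ℤ) - (x.1 j : ℤ)) = simpStep i

/-- The corner of `Δ_{d,L}` whose `i`-th coordinate is `L`. -/
def corner (d L : ℕ) (i : Fin d) : Simp d L :=
  ⟨Pi.single i L, by simp⟩

/-! ### Standard cylindric tableaux -/

/-- The cylinder `ℤ² / ℤ(-d, L)`, whose elements are the cells. -/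
abbrev Cylinder (d L : ℕ) : Type :=
  (ℤ × ℤ) ⧸ AddSubgroup.zmultiples ((-(d : ℤ), (L : ℤ)) : ℤ × ℤ)

/-- The cell `⟨i, j⟩` in row `i` and column `j`. -/
def cell (d L : ℕ) (i j : ℤ) : Cylinder d L := QuotientAddGroup.mk (i, j)

/-- Cylindric shapes of period `(d, L)`. -/
structure CylShape (d L : ℕ) where
  /-- the doubly infinite sequence of row lengths -/
  row : ℤ → ℤ
  anti : Antitone row
  periodic : ∀ i, row i = row (i + d) + L

namespace CylShape

variable {d L : ℕ}

/-- Containment of cylindric shapes. -/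
instance : LE (CylShape d L) := ⟨fun μ lam => ∀ i, μ.row i ≤ lam.row i⟩

/-- The Young diagram of a cylindric shape. -/
def diagram (lam : CylShape d L) : Set (Cylinder d L) :=
  {c | ∃ i j : ℤ, c = cell d L i j ∧ j ≤ lam.row i}

/-- The cylindric Young diagram of shape `lam/μ`. -/
def skewDiagram (lam μ : CylShape d L) : Set (Cylinder d L) := lam.diagram \ μ.diagram

/-- The cylindric shape `[0, 0, …, 0]` of period `(d, L)`: its rows `1, …, d` are `0`. -/
def rect (d L : ℕ) [NeZero d] : CylShape d L where
  row i := -((L : ℤ) * ((i - 1) / (d : ℤ)))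
  anti := by
    intro i j hij
    have hd : (0 : ℤ) < d := by exact_mod_cast Nat.pos_of_ne_zero (NeZero.ne d)
    have h : (i - 1) / (d : ℤ) ≤ (j - 1) / (d : ℤ) :=
      Int.ediv_le_ediv hd (by linarith)
    have hL : (0 : ℤ) ≤ L := Int.natCast_nonneg L
    exact neg_le_neg (mul_le_mul_of_nonneg_left h hL)
  periodic := by
    intro i
    have hd : (d : ℤ) ≠ 0 := by exact_mod_cast NeZero.ne d
    have h : (i + d - 1) / (d : ℤ) = (i - 1) / (d : ℤ) + 1 := by
      rw [show i + (d : ℤ) - 1 = (i - 1) + d by ring, Int.add_ediv_of_dvd_right (dvd_refl _),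
        Int.ediv_self hd]
    rw [h]
    ring

theorem rect_row (d L : ℕ) [NeZero d] (i : ℤ) (h1 : 1 ≤ i) (h2 : i ≤ d) :
    (rect d L).row i = 0 := by
  have h : (i - 1) / (d : ℤ) = 0 := Int.ediv_eq_zero_of_lt (by linarith) (by linarith)
  simp [rect, h]

end CylShape

/-- Standard cylindric tableaux of shape `lam/μ`: bijective fillings of the cells of `lam/μ`
with `1, …, |lam/μ|`, increasing along rows and along columns. -/
structure SCT {d L : ℕ} (lam μ : CylShape d L) where
  /-- the entries -/
  entry : lam.skewDiagram μ → ℕ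
  bij : Set.BijOn entry Set.univ (Set.Icc 1 (lam.skewDiagram μ).ncard)
  col_lt : ∀ (i j : ℤ) (h : cell d L i j ∈ lam.skewDiagram μ)
    (h' : cell d L (i + 1) j ∈ lam.skewDiagram μ), entry ⟨_, h⟩ < entry ⟨_, h'⟩
  row_lt : ∀ (i j : ℤ) (h : cell d L i j ∈ lam.skewDiagram μ)
    (h' : cell d L i (j + 1) ∈ lam.skewDiagram μ), entry ⟨_, h⟩ < entry ⟨_, h'⟩

/-- Standard cylindric tableaux of period `(d, L)` with `n` cells and inner shape `μ`. -/
abbrev SCTInner {d L : ℕ} (μ : CylShape d L) (n : ℕ) : Type :=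
  Σ lam : {lam : CylShape d L //
      μ ≤ lam ∧ (lam.skewDiagram μ).Finite ∧ (lam.skewDiagram μ).ncard = n},
    SCT lam.1 μ

/-! ### The exclusion process -/

/-- States of the TASEP on the cycle `ℤ/(d+L)` with `d` particles (and `L` empty sites);
`true` marks a particle. -/
abbrev TState (d L : ℕ) : Type :=
  {u : ZMod (d + L) → Bool // {r | u r = true}.ncard = d}

/-- The directed graph of valid jumps: there is an edge from `u` to `v` when `v` is obtained
from `u` by replacing one cyclic occurrence of `01` by `10`. -/
def tasepGraph (d L : ℕ) : Digraph (TState d L) where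
  Adj u v := ∃ r : ZMod (d + L),
    (u.1 (r - 1) = false ∧ u.1 r = true) ∧ (v.1 (r - 1) = true ∧ v.1 r = false) ∧
      ∀ t, t ≠ r - 1 → t ≠ r → u.1 t = v.1 t

/-- The state `1^d 0^L`: the particles are at the sites `1, …, d`. -/
noncomputable def blockState (d L : ℕ) : TState d L := by
  classical
  exact ⟨fun r => decide (∃ k : ℕ, 1 ≤ k ∧ k ≤ d ∧ r = (k : ZMod (d + L))), by
    have h : {r : ZMod (d + L) |
        decide (∃ k : ℕ, 1 ≤ k ∧ k ≤ d ∧ r = (k : ZMod (d + L))) = true} =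
        (fun k : ℕ => (k : ZMod (d + L))) '' (Finset.Icc 1 d : Finset ℕ) := by
      ext r
      simp only [decide_eq_true_eq, Set.mem_ofPred_eq, Set.mem_image, Finset.coe_Icc,
        Set.mem_Icc]
      constructor
      · rintro ⟨k, h1, h2, rfl⟩
        exact ⟨k, ⟨h1, h2⟩, rfl⟩
      · rintro ⟨k, ⟨h1, h2⟩, rfl⟩
        exact ⟨k, h1, h2, rfl⟩
    rw [h, Set.InjOn.ncard_image, Set.ncard_coe_finset]
    · simp
    · intro a ha b hb hab
      simp only [Finset.coe_Icc, Set.mem_Icc] at ha hb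
      have hm : a ≡ b [MOD (d + L)] := (ZMod.natCast_eq_natCast_iff a b (d + L)).1 hab
      apply hm.eq_of_abs_lt
      rw [abs_lt]
      constructor <;> push_cast <;> omega⟩

/-- Two states are equivalent when they differ by a cyclic rotation. -/
instance rotSetoid (d L : ℕ) : Setoid (TState d L) where
  r u v := ∃ t : ZMod (d + L), ∀ r, u.1 r = v.1 (r + t)
  iseqv :=
    { refl := fun u => ⟨0, fun r => by rw [add_zero]⟩
      symm := by
        rintro u v ⟨t, h⟩
        exact ⟨-t, fun r => by rw [h (r + -t), neg_add_cancel_right]⟩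
      trans := by
        rintro u v w ⟨t, h⟩ ⟨s, h'⟩
        exact ⟨t + s, fun r => by rw [h r, h' (r + t), add_assoc]⟩ }

/-- Necklaces: states up to cyclic rotation. -/
abbrev Necklace (d L : ℕ) : Type := Quotient (rotSetoid d L)

/-- Rotation of a state. -/
def rot {d L : ℕ} (t : ZMod (d + L)) (u : TState d L) : TState d L :=
  ⟨fun r => u.1 (r + t), by
    have h : {r | u.1 (r + t) = true} = (fun r => r + -t) '' {r | u.1 r = true} := by
      ext r
      simp
    rw [h, Set.ncard_image_of_injective _ (add_left_injective _), u.2]⟩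

theorem rot_adj {d L : ℕ} (t : ZMod (d + L)) {u v : TState d L}
    (h : (tasepGraph d L).Adj u v) : (tasepGraph d L).Adj (rot t u) (rot t v) := by
  obtain ⟨r, ⟨h1, h2⟩, ⟨h3, h4⟩, h5⟩ := h
  refine ⟨r - t, ⟨?_, ?_⟩, ⟨?_, ?_⟩, ?_⟩
  · simpa [rot, show r - t - 1 + t = r - 1 by abel] using h1
  · simpa [rot] using h2
  · simpa [rot, show r - t - 1 + t = r - 1 by abel] using h3
  · simpa [rot] using h4
  · intro s hs1 hs2
    refine h5 (s + t) (fun hh => hs1 ?_) (fun hh => hs2 ?_)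
    · rw [eq_sub_of_add_eq hh]; abel
    · exact eq_sub_of_add_eq hh

theorem rot_rot_neg {d L : ℕ} (t : ZMod (d + L)) (u : TState d L) : rot t (rot (-t) u) = u := by
  apply Subtype.ext
  funext r
  simp [rot]

theorem rot_neg_rot {d L : ℕ} (t : ZMod (d + L)) (u : TState d L) : rot (-t) (rot t u) = u := by
  apply Subtype.ext
  funext r
  simp [rot]

theorem mk_rot {d L : ℕ} (t : ZMod (d + L)) (u : TState d L) :
    (Quotient.mk (rotSetoid d L) (rot t u)) = Quotient.mk (rotSetoid d L) u :=
  Quotient.sound ⟨t, fun _ => rfl⟩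

/-- The number of states in the necklace `b` to which there is an edge from the state `u`. -/
noncomputable def jumpCount {d L : ℕ} (u : TState d L) (b : Necklace d L) : ℕ :=
  Nat.card {v : TState d L // (tasepGraph d L).Adj u v ∧ Quotient.mk (rotSetoid d L) v = b}

theorem jumpCount_congr {d L : ℕ} (u v : TState d L) (h : u ≈ v) :
    (jumpCount u : Necklace d L → ℕ) = jumpCount v := by
  obtain ⟨t, ht⟩ := h
  have huv : u = rot t v := Subtype.ext (funext ht)
  subst huv
  funext b
  refine Nat.card_congr
    { toFun := fun w => ⟨rot (-t) w.1, ?_, ?_⟩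
      invFun := fun w => ⟨rot t w.1, rot_adj t w.2.1, (mk_rot t w.1).trans w.2.2⟩
      left_inv := fun w => Subtype.ext (rot_rot_neg t w.1)
      right_inv := fun w => Subtype.ext (rot_neg_rot t w.1) }
  · have := rot_adj (-t) w.2.1
    rwa [rot_neg_rot] at this
  · exact (mk_rot (-t) w.1).trans w.2.2

/-- The directed multigraph of necklaces: the number of edges from the necklace of `u` to the
necklace `b` is the number of states in `b` to which there is an edge from `u`. -/
noncomputable def necklaceGraph (d L : ℕ) : DiMultigraph (Necklace d L) where
  mult := Quotient.lift jumpCount jumpCount_congr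

/-! ### The generating function -/

/-- `ζ = exp(iπ/(L+4))`. -/
noncomputable def zeta (L : ℕ) : ℂ := Complex.exp (Complex.I * Real.pi / ((L : ℂ) + 4))

/-- `ζ^k + ζ^{-k}`. -/
noncomputable def zsum (L k : ℕ) : ℂ := zeta L ^ k + (zeta L ^ k)⁻¹

/-- The power series
`(L+4)^{-2} ∑ (ζ^k+ζ^{-k}-ζ^j-ζ^{-j})² (2+ζ^j+ζ^{-j}) (2+ζ^k+ζ^{-k}) /`
`(1-(ζ^j+ζ^{-j}+ζ^k+ζ^{-k})t)`, where the sum is over odd `j < k` with `1 ≤ j` and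
`k ≤ L+3`. -/
noncomputable def rootGF (L : ℕ) : PowerSeries ℂ :=
  PowerSeries.C (1 / ((L : ℂ) + 4) ^ 2) *
    ∑ p ∈ (Finset.Icc 1 (L + 3) ×ˢ Finset.Icc 1 (L + 3)).filter
        (fun p : ℕ × ℕ => p.1 < p.2 ∧ Odd p.1 ∧ Odd p.2),
      PowerSeries.C ((zsum L p.2 - zsum L p.1) ^ 2 * (2 + zsum L p.1) * (2 + zsum L p.2)) *
        (1 - PowerSeries.C (zsum L p.1 + zsum L p.2) * PowerSeries.X)⁻¹

end Cylindric

open Cylindric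

/-! All five families are walks in one graph, whose vertices are the cylindric shapes and whose
edges add a single cell. A tableau with inner shape μ is the record of the order in which cells are
added to μ. The other graphs are images of the shape graph under maps that are bijective on
out-neighbours (`IsCovering`), so walks lift uniquely and are equinumerous. Differences of
successive rows give a point of Δ_{d,L}; row lengths modulo L, counted over one period, give a point
of Δ_{L,d}; the residues of `i - lam.row i` modulo d + L give a particle configuration. For
necklaces, the out-neighbours of a state are grouped by rotation class.

It remains to count walks in Δ_{4,L} from a corner. A point of Δ_{4,L} is a configuration of four
particles on a cycle of N = L + 4 sites, the coordinates counting the empty sites in between, and a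
walk never lets particles collide. The count is a Pfaffian: for a function b of distances, b₁₂b₃₄ -
b₁₃b₂₄ + b₁₄b₂₃. If the constant 1 on 0 < m < N is a sum of modes b_j(m) with b_j(m+1) + b_j(m-1) =
z_j b_j(m), b_j(0) = 0 and b_j(N-m) = b_j(m), then weighting the pair (j, k) by (z_j + z_k)^n gives
a function that equals 1 for n = 0, obeys the recursion of the walks (`pfaffianSum_step`) and
vanishes at collisions (`pfaffianSum_boundary`). Sines at odd multiples of π/N are such modes
(`sum_modeCoeff`). With all three distances equal to 1, symmetrizing in j and k yields the
coefficient of F_L. -/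

namespace Cylindric

/-! ### Walks and coverings -/

/-- A walk of positive length is a first step followed by a walk. -/
def DiWalk.consEquiv {V : Type*} (G : Digraph V) (u : V) (n : ℕ) :
    DiWalk G u (n + 1) ≃ Σ v : {v : V // G.Adj u v}, DiWalk G v.1 n where
  toFun w := ⟨⟨w.1 1, by have := w.2.2 0; rwa [Fin.castSucc_zero, w.2.1] at this⟩,
    ⟨fun k => w.1 k.succ, rfl, fun k => w.2.2 k.succ⟩⟩
  invFun p := ⟨Fin.cons u p.2.1, rfl, by
    intro k
    refine Fin.cases ?_ (fun k => ?_) k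
    · rw [Fin.castSucc_zero, Fin.cons_zero, Fin.cons_succ, p.2.2.1]
      exact p.1.2
    · rw [← Fin.succ_castSucc, Fin.cons_succ, Fin.cons_succ]
      exact p.2.2.2 k⟩
  left_inv w := by
    apply Subtype.ext
    funext k
    refine Fin.cases ?_ (fun k => ?_) k
    · exact w.2.1.symm
    · rfl
  right_inv p := by
    obtain ⟨⟨v, hv⟩, ⟨w, h0, hw⟩⟩ := p
    have h0 : w 0 = v := h0
    subst h0
    rfl

/-- Walks of length zero are trivial. -/
def DiWalk.zeroEquiv {V : Type*} (G : Digraph V) (u : V) : DiWalk G u 0 ≃ Unit where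
  toFun _ := ()
  invFun _ := ⟨fun _ => u, rfl, fun k => k.elim0⟩
  left_inv w := by
    apply Subtype.ext
    funext k
    rw [show k = 0 from Subsingleton.elim (α := Fin 1) k 0]
    exact w.2.1.symm
  right_inv _ := rfl

/-- A map of directed graphs which is bijective on the out-neighbours of each vertex. -/
structure IsCovering {V W : Type*} (G : Digraph V) (H : Digraph W) (f : V → W) : Prop where
  map : ∀ {u v}, G.Adj u v → H.Adj (f u) (f v)
  inj : ∀ {u v v'}, G.Adj u v → G.Adj u v' → f v = f v' → v = v'
  surj : ∀ {u w}, H.Adj (f u) w → ∃ v, G.Adj u v ∧ f v = w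

/-- Each step of a walk from `f u` has exactly one lift, once the preceding vertex has been lifted.
-/
theorem IsCovering.nonempty_equiv {V W : Type*} {G : Digraph V} {H : Digraph W} {f : V → W}
    (hf : IsCovering G H f) (n : ℕ) (u : V) :
    Nonempty (DiWalk G u n ≃ DiWalk H (f u) n) := by
  induction n generalizing u with
  | zero => exact ⟨(DiWalk.zeroEquiv G u).trans (DiWalk.zeroEquiv H (f u)).symm⟩
  | succ n ih =>
    let g : {v : V // G.Adj u v} → {w : W // H.Adj (f u) w} := fun v => ⟨f v.1, hf.map v.2⟩
    have hg : Function.Bijective g := by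
      constructor
      · intro v v' h
        exact Subtype.ext (hf.inj v.2 v'.2 (congrArg Subtype.val h))
      · rintro ⟨w, hw⟩
        obtain ⟨v, hv, rfl⟩ := hf.surj hw
        exact ⟨⟨v, hv⟩, rfl⟩
    exact ⟨(DiWalk.consEquiv G u n).trans
      ((Equiv.sigmaCongr (Equiv.ofBijective g hg) (fun v => (ih v.1).some)).trans
        (DiWalk.consEquiv H (f u) n).symm)⟩

/-- With `ENat.card`, finiteness passes from a finite graph to the walks in the infinite shape
graph. -/
theorem IsCovering.card_eq {V W : Type*} {G : Digraph V} {H : Digraph W} {f : V → W}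
    (hf : IsCovering G H f) (n : ℕ) (u : V) :
    ENat.card (DiWalk G u n) = ENat.card (DiWalk H (f u) n) :=
  let ⟨e⟩ := hf.nonempty_equiv n u
  ENat.card_congr e

/-- The first step of a sequence. -/
def headEquiv {V : Type*} (u : V) (n : ℕ) :
    {w : Fin (n + 2) → V // w 0 = u} ≃ Σ v : V, {w : Fin (n + 1) → V // w 0 = v} where
  toFun w := ⟨w.1 1, ⟨fun k => w.1 k.succ, rfl⟩⟩
  invFun p := ⟨Fin.cons u p.2.1, rfl⟩
  left_inv w := by
    apply Subtype.ext
    funext k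
    refine Fin.cases ?_ (fun k => ?_) k
    · exact w.2.symm
    · rfl
  right_inv p := by
    obtain ⟨v, ⟨w, rfl⟩⟩ := p
    rfl

theorem MultiWalk.card_eq {V : Type*} [Finite V] (G : DiMultigraph V) (u : V) (n : ℕ)
    [Fintype {w : Fin (n + 1) → V // w 0 = u}] :
    Nat.card (MultiWalk G u n) = ∑ w : {w : Fin (n + 1) → V // w 0 = u},
      ∏ k : Fin n, G.mult (w.1 k.castSucc) (w.1 k.succ) := by
  rw [Nat.card_sigma]
  simp only [Nat.card_eq_fintype_card, Fintype.card_pi, Fintype.card_fin]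

theorem MultiWalk.card_zero {V : Type*} [Finite V] (G : DiMultigraph V) (u : V) :
    Nat.card (MultiWalk G u 0) = 1 := by
  classical
  have := Fintype.ofFinite V
  rw [MultiWalk.card_eq]
  simp only [Finset.univ_eq_empty, Finset.prod_empty, Finset.sum_const, Finset.card_univ,
    smul_eq_mul, mul_one]
  rw [Fintype.card_eq_one_iff]
  refine ⟨⟨fun _ => u, rfl⟩, fun w => Subtype.ext (funext fun k => ?_)⟩
  rw [show k = 0 from Subsingleton.elim (α := Fin 1) k 0]
  exact w.2

theorem MultiWalk.card_succ {V : Type*} [Fintype V] (G : DiMultigraph V) (u : V) (n : ℕ) :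
    Nat.card (MultiWalk G u (n + 1)) = ∑ v, G.mult u v * Nat.card (MultiWalk G v n) := by
  classical
  simp only [MultiWalk.card_eq]
  rw [← (headEquiv u n).symm.sum_comp, Fintype.sum_sigma]
  refine Finset.sum_congr rfl fun v _ => ?_
  rw [Finset.mul_sum]
  refine Finset.sum_congr rfl fun w _ => ?_
  rw [Fin.prod_univ_succ]
  have h0 : (((headEquiv u n).symm ⟨v, w⟩).1 : Fin (n + 2) → V) = Fin.cons u w.1 := rfl
  rw [h0]
  simp only [Fin.castSucc_zero, Fin.cons_zero, Fin.cons_succ, ← Fin.succ_castSucc, w.2]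

theorem DiWalk.card_zero {V : Type*} (G : Digraph V) (u : V) : Nat.card (DiWalk G u 0) = 1 := by
  rw [Nat.card_congr (DiWalk.zeroEquiv G u)]
  simp

theorem DiWalk.card_succ {V : Type*} [Finite V] (G : Digraph V) (u : V) (n : ℕ)
    [Fintype {v : V // G.Adj u v}] :
    Nat.card (DiWalk G u (n + 1)) = ∑ v : {v : V // G.Adj u v}, Nat.card (DiWalk G v.1 n) := by
  rw [Nat.card_congr (DiWalk.consEquiv G u n), Nat.card_sigma]

/-! ### Necklaces -/

/-- The multiplicity from `[u]` to `b` counts the out-neighbours of `u` in `b`, so grouping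
out-neighbours by necklace identifies the two recursions. -/
theorem card_necklace_walk (d L : ℕ) [NeZero (d + L)] (n : ℕ) (u : TState d L) :
    Nat.card (MultiWalk (necklaceGraph d L) (Quotient.mk (rotSetoid d L) u) n) =
      Nat.card (DiWalk (tasepGraph d L) u n) := by
  classical
  have := Fintype.ofFinite (Necklace d L)
  have := Fintype.ofFinite (TState d L)
  induction n generalizing u with
  | zero => rw [MultiWalk.card_zero, DiWalk.card_zero]
  | succ n ih =>
    rw [MultiWalk.card_succ, DiWalk.card_succ]
    simp only [← ih]
    rw [← Finset.sum_fiberwise Finset.univ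
      (fun v : {v // (tasepGraph d L).Adj u v} => Quotient.mk (rotSetoid d L) v.1)]
    refine Finset.sum_congr rfl fun b _ => ?_
    have h : (necklaceGraph d L).mult (Quotient.mk (rotSetoid d L) u) b = (Finset.univ.filter
        fun v : {v // (tasepGraph d L).Adj u v} => Quotient.mk (rotSetoid d L) v.1 = b).card := by
      change jumpCount u b = _
      rw [jumpCount, ← Fintype.card_subtype, ← Nat.card_eq_fintype_card]
      exact Nat.card_congr (Equiv.subtypeSubtypeEquivSubtypeInter _
        (fun v => Quotient.mk (rotSetoid d L) v = b)).symm
    rw [h, Finset.card_eq_sum_ones, Finset.sum_mul]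
    refine Finset.sum_congr rfl fun v hv => ?_
    rw [one_mul, (Finset.mem_filter.1 hv).2]


/-! ### The graph of cylindric shapes -/

namespace CylShape

variable {d L : ℕ}

theorem ext_row {lam μ : CylShape d L} (h : ∀ i, lam.row i = μ.row i) : lam = μ := by
  cases lam
  cases μ
  congr
  exact funext h

theorem row_add_mul (lam : CylShape d L) (i k : ℤ) : lam.row (i + k * d) = lam.row i - k * L := by
  induction k with
  | zero => simp
  | succ k ih =>
    have := lam.periodic (i + k * d)
    rw [show i + ((k : ℤ) + 1) * d = i + k * d + d by ring]
    linarith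
  | pred k ih =>
    have := lam.periodic (i + (-(k : ℤ) - 1) * d)
    rw [show i + (-(k : ℤ) - 1) * d + d = i + -(k : ℤ) * d by ring] at this
    linarith

/-- A cell can be added in row `i`. -/
def Addable (lam : CylShape d L) (i : ℤ) : Prop := lam.row i < lam.row (i - 1)

/-- Adding a cell in row `i`. -/
def addCell (lam : CylShape d L) (i : ℤ) (h : lam.Addable i) : CylShape d L where
  row k := lam.row k + if (d : ℤ) ∣ k - i then 1 else 0
  anti := by
    refine antitone_int_of_succ_le fun k => ?_
    have h0 : lam.row (k + 1) ≤ lam.row k := lam.anti (by omega)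
    -- Monotonicity is at risk only where row k + 1 is lengthened; then rows k and k + 1 are
    -- translates of rows i - 1 and i.
    by_cases h1 : (d : ℤ) ∣ k + 1 - i
    · obtain ⟨c, hc⟩ := h1
      have h2 := lam.row_add_mul i c
      have h3 := lam.row_add_mul (i - 1) c
      rw [show i + c * d = k + 1 by linarith] at h2
      rw [show i - 1 + c * d = k by linarith] at h3
      unfold Addable at h
      split_ifs <;> linarith
    · rw [if_neg h1]
      split_ifs <;> linarith
  periodic k := by
    have h : (d : ℤ) ∣ k - i ↔ (d : ℤ) ∣ k + d - i :=
      Int.dvd_iff_dvd_of_dvd_sub ⟨-1, by ring⟩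
    simp only [← h]
    rw [lam.periodic k]
    ring

/-- `lam'` is obtained from `lam` by adding a cell in row `i`. -/
def AddsCell (lam lam' : CylShape d L) (i : ℤ) : Prop :=
  ∀ k, lam'.row k = lam.row k + if (d : ℤ) ∣ k - i then 1 else 0

theorem addsCell_addCell (lam : CylShape d L) (i : ℤ) (h : lam.Addable i) :
    lam.AddsCell (lam.addCell i h) i := fun _ => rfl

/-- For d = 1 successive rows differ by L > 0. This case stands apart because adding a cell
lengthens row i - 1 along with row i. -/
theorem addable_of_dvd_one [NeZero L] (lam : CylShape d L) (h : (d : ℤ) ∣ 1) (i : ℤ) :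
    lam.Addable i := by
  have hL : 0 < L := Nat.pos_of_ne_zero (NeZero.ne L)
  have h1 : (d : ℤ) = 1 := Int.eq_one_of_dvd_one (by omega) h
  have h2 := lam.periodic (i - 1)
  rw [h1, sub_add_cancel] at h2
  unfold Addable
  omega

theorem AddsCell.addable [NeZero L] {lam lam' : CylShape d L} {i : ℤ} (h : lam.AddsCell lam' i) :
    lam.Addable i := by
  by_cases h1 : (d : ℤ) ∣ 1
  · exact lam.addable_of_dvd_one h1 i
  · have h2 := h i
    have h3 := h (i - 1)
    rw [if_pos (by simp)] at h2
    rw [if_neg (by rwa [show i - 1 - i = -1 by ring, dvd_neg])] at h3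
    have h4 : lam'.row i ≤ lam'.row (i - 1) := lam'.anti (by omega)
    unfold Addable
    omega

theorem AddsCell.eq_of_dvd {lam lam₁ lam₂ : CylShape d L} {i j : ℤ} (h₁ : lam.AddsCell lam₁ i)
    (h₂ : lam.AddsCell lam₂ j) (h : (d : ℤ) ∣ i - j) : lam₁ = lam₂ := by
  refine ext_row fun k => ?_
  rw [h₁ k, h₂ k]
  have : (d : ℤ) ∣ k - i ↔ (d : ℤ) ∣ k - j :=
    Int.dvd_iff_dvd_of_dvd_sub (by rw [show k - i - (k - j) = -(i - j) by ring]; exact h.neg_right)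
  simp only [this]

end CylShape

/-- The directed graph of cylindric shapes, in which an edge adds one cell. -/
def shapeGraph (d L : ℕ) : Digraph (CylShape d L) where
  Adj lam lam' := ∃ i, lam.AddsCell lam' i

/-! ### Steps in simplices -/

theorem exists_fin_dvd (d : ℕ) [NeZero d] (a : ℤ) : ∃ m : Fin d, (d : ℤ) ∣ a - m := by
  have hd : (0 : ℤ) < d := by exact_mod_cast Nat.pos_of_ne_zero (NeZero.ne d)
  have h1 := Int.emod_nonneg a hd.ne'
  have h2 := Int.emod_lt_of_pos a hd
  refine ⟨⟨(a % d).toNat, by omega⟩, a / d, ?_⟩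
  have h3 := Int.emod_add_mul_ediv a d
  simp only [Int.toNat_of_nonneg h1]
  linarith

theorem fin_dvd_iff {d : ℕ} (k m : Fin d) : (d : ℤ) ∣ (k : ℤ) - m ↔ k = m := by
  constructor
  · intro h
    have := Int.eq_zero_of_abs_lt_dvd h (by rw [abs_lt]; constructor <;> omega)
    apply Fin.ext
    omega
  · rintro rfl
    simp

theorem dvd_finRotate {d : ℕ} (m : Fin d) : (d : ℤ) ∣ ((finRotate d m : Fin d) : ℤ) - (m + 1) := by
  obtain _ | d := d
  · exact m.elim0
  · rw [coe_finRotate]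
    split_ifs with h
    · subst h
      exact ⟨-1, by simp⟩
    · simp

theorem simpStep_apply {d : ℕ} (m k : Fin d) : simpStep m k =
    (if (d : ℤ) ∣ k - (m + 1) then 1 else 0) - (if (d : ℤ) ∣ k - m then 1 else 0) := by
  have h : (d : ℤ) ∣ k - (m + 1) ↔ k = finRotate d m := by
    rw [← fin_dvd_iff]
    refine Int.dvd_iff_dvd_of_dvd_sub ?_
    rw [show (k : ℤ) - (m + 1) - (k - (finRotate d m : Fin d)) =
      (finRotate d m : Fin d) - (m + 1) by ring]
    exact dvd_finRotate m
  simp only [h, fin_dvd_iff, simpStep, Pi.sub_apply, Pi.single_apply]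

/-- A step is negative only at its own index, except for d = 1, where it is zero but there is only
one index. -/
theorem simpStep_injective {d : ℕ} : Function.Injective (simpStep (d := d)) := by
  intro m m' h
  by_contra hne
  have h1 := congrFun h m
  simp only [simpStep_apply, fin_dvd_iff, if_neg hne, if_true] at h1
  have h2 : (d : ℤ) ∣ (m : ℤ) - (m + 1) := by
    by_contra h3
    rw [if_neg h3] at h1
    split_ifs at h1 <;> omega
  have h3 : (d : ℤ) ∣ 1 := by simpa using h2
  exact hne ((fin_dvd_iff m m').1 (h3.trans (one_dvd _)))

theorem pos_of_sub_eq_simpStep {d M : ℕ} {x y : Simp d M} {m : Fin d} (hd : ¬(d : ℤ) ∣ 1)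
    (h : (fun j => (y.1 j : ℤ) - (x.1 j : ℤ)) = simpStep m) : 0 < x.1 m := by
  have h1 := congrFun h m
  simp only [simpStep_apply] at h1
  rw [if_neg (by simpa using hd), if_pos (by simp)] at h1
  omega

theorem Simp.ext_of_sub {d M : ℕ} {x y z : Simp d M} {s : Fin d → ℤ}
    (h : (fun j => (y.1 j : ℤ) - (x.1 j : ℤ)) = s)
    (h' : (fun j => (z.1 j : ℤ) - (x.1 j : ℤ)) = s) : y = z := by
  apply Subtype.ext
  funext k
  have : (y.1 k : ℤ) - x.1 k = z.1 k - x.1 k := congrFun (h.trans h'.symm) k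
  omega

theorem eq_corner {d M : ℕ} {x : Simp d M} {i : Fin d} (h : x.1 i = M) : x = corner d M i := by
  apply Subtype.ext
  funext k
  by_cases hk : k = i
  · subst hk
    simp [corner, h]
  · have h1 := x.2
    rw [← Finset.add_sum_erase _ _ (Finset.mem_univ i), h] at h1
    have h2 : ∑ j ∈ Finset.univ.erase i, x.1 j = 0 := by omega
    rw [Finset.sum_eq_zero_iff] at h2
    simp [corner, hk, h2 k (by simp [hk])]

/-! ### Differences of successive rows -/

/-- The differences of successive rows, as a point of a simplex. -/
def gapMap {d L : ℕ} (t : ℤ) (lam : CylShape d L) : Simp d L :=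
  ⟨fun i => (lam.row (i - t) - lam.row (i + 1 - t)).toNat, by
    have h : ∀ i : ℤ, 0 ≤ lam.row (i - t) - lam.row (i + 1 - t) := fun i =>
      sub_nonneg.2 (lam.anti (by omega))
    zify
    simp only [Int.toNat_of_nonneg (h _)]
    rw [Fin.sum_univ_eq_sum_range (fun i : ℕ => lam.row ((i : ℤ) - t) - lam.row ((i : ℤ) + 1 - t))]
    have h1 := Finset.sum_range_sub' (fun i : ℕ => lam.row ((i : ℤ) - t)) d
    push_cast at h1
    rw [h1]
    have h2 := lam.periodic (0 - t)
    rw [show 0 - t + (d : ℤ) = d - t by ring] at h2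
    linarith⟩

theorem gapMap_apply {d L : ℕ} (t : ℤ) (lam : CylShape d L) (i : Fin d) :
    ((gapMap t lam).1 i : ℤ) = lam.row (i - t) - lam.row (i + 1 - t) :=
  Int.toNat_of_nonneg (sub_nonneg.2 (lam.anti (by omega)))

/-- A longer row i narrows the gap above it, at index i + t - 1, and widens the gap below it, at
index i + t. -/
theorem gapMap_sub {d L : ℕ} {t : ℤ} {lam lam' : CylShape d L} {i : ℤ} (h : lam.AddsCell lam' i)
    {m : Fin d} (hm : (d : ℤ) ∣ i + t - 1 - m) :
    (fun j => ((gapMap t lam').1 j : ℤ) - ((gapMap t lam).1 j : ℤ)) = simpStep m := by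
  funext k
  rw [gapMap_apply, gapMap_apply, h, h, simpStep_apply]
  have h1 : (d : ℤ) ∣ k - (m + 1) ↔ (d : ℤ) ∣ k - t - i :=
    Int.dvd_iff_dvd_of_dvd_sub
      (by rwa [show (k : ℤ) - (m + 1) - (k - t - i) = i + t - 1 - m by ring])
  have h2 : (d : ℤ) ∣ k - m ↔ (d : ℤ) ∣ k + 1 - t - i :=
    Int.dvd_iff_dvd_of_dvd_sub
      (by rwa [show (k : ℤ) - m - (k + 1 - t - i) = i + t - 1 - m by ring])
  simp only [h1, h2]
  ring

/-- For d > 1, a row accepts a cell exactly when the gap above it is positive, which is also the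
condition for the step to stay in the simplex. -/
theorem gapMap_isCovering (d L : ℕ) [NeZero d] [NeZero L] (t : ℤ) :
    IsCovering (shapeGraph d L) (simpGraph d L) (gapMap t) where
  map := by
    rintro u v ⟨i, hi⟩
    obtain ⟨m, hm⟩ := exists_fin_dvd d (i + t - 1)
    exact ⟨m, gapMap_sub hi hm⟩
  inj := by
    rintro u v v' ⟨i, hi⟩ ⟨j, hj⟩ h
    obtain ⟨m, hm⟩ := exists_fin_dvd d (i + t - 1)
    obtain ⟨m', hm'⟩ := exists_fin_dvd d (j + t - 1)
    have h1 := gapMap_sub hi hm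
    rw [h, gapMap_sub hj hm'] at h1
    rw [simpStep_injective h1] at hm'
    refine hi.eq_of_dvd hj ?_
    rw [show i - j = i + t - 1 - m - (j + t - 1 - m) by ring]
    exact dvd_sub hm hm'
  surj := by
    rintro u w ⟨m, hm⟩
    have h : u.Addable ((m : ℤ) + 1 - t) := by
      by_cases hd : (d : ℤ) ∣ 1
      · exact u.addable_of_dvd_one hd _
      · have h1 := pos_of_sub_eq_simpStep hd hm
        have h2 := gapMap_apply t u m
        rw [CylShape.Addable, show (m : ℤ) + 1 - t - 1 = m - t by ring]
        omega
    have h' := u.addsCell_addCell _ h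
    exact ⟨_, ⟨_, h'⟩, Simp.ext_of_sub (gapMap_sub h' (by ring_nf; simp)) hm⟩

/-- The only nonzero gap in a period is the one between rows 0 and 1; the offset brings it to any
prescribed coordinate. -/
theorem gapMap_rect (d L : ℕ) [NeZero d] (i : Fin d) :
    gapMap (i : ℤ) (CylShape.rect d L) = corner d L i := by
  apply eq_corner
  have hd : 1 ≤ d := Nat.one_le_iff_ne_zero.2 (NeZero.ne d)
  have h := gapMap_apply (i : ℤ) (CylShape.rect d L) i
  have h1 := (CylShape.rect d L).periodic 0
  rw [zero_add, CylShape.rect_row d L d (by omega) le_rfl] at h1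
  rw [sub_self, h1, show (i : ℤ) + 1 - i = 1 by ring,
    CylShape.rect_row d L 1 le_rfl (by omega)] at h
  omega

/-! ### Row lengths modulo `L` -/

theorem sum_dvd_eq_one (L : ℕ) [NeZero L] (a : ℤ) :
    ∑ r : Fin L, (if (L : ℤ) ∣ a - r then 1 else 0) = 1 := by
  obtain ⟨m, hm⟩ := exists_fin_dvd L a
  have h : ∀ r : Fin L, (L : ℤ) ∣ a - r ↔ m = r := fun r => by
    rw [← fin_dvd_iff]
    refine Int.dvd_iff_dvd_of_dvd_sub ?_
    rwa [show a - r - ((m : ℤ) - r) = a - m by ring]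
  simp only [h, Finset.sum_ite_eq, Finset.mem_univ, if_true]

/-- The numbers of rows, in one period, with given lengths modulo `L`. -/
def residueMap {d L : ℕ} [NeZero L] (t : ℤ) (lam : CylShape d L) : Simp L d :=
  ⟨fun r => ∑ i : Fin d, if (L : ℤ) ∣ lam.row (i + 1) + t - r then 1 else 0, by
    rw [Finset.sum_comm]
    simp only [sum_dvd_eq_one]
    simp⟩

theorem CylShape.row_dvd {d L : ℕ} (lam : CylShape d L) {i j : ℤ} (h : (d : ℤ) ∣ i - j) :
    (L : ℤ) ∣ lam.row i - lam.row j := by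
  obtain ⟨c, hc⟩ := h
  have := lam.row_add_mul j c
  rw [show j + c * d = i by linarith] at this
  exact ⟨-c, by rw [this]; ring⟩

theorem residueMap_sub {d L : ℕ} [NeZero d] [NeZero L] {t : ℤ} {lam lam' : CylShape d L} {i : ℤ}
    (h : lam.AddsCell lam' i) {m : Fin L} (hm : (L : ℤ) ∣ lam.row i + t - m) :
    (fun j => ((residueMap t lam').1 j : ℤ) - ((residueMap t lam).1 j : ℤ)) = simpStep m := by
  funext k
  -- Row p + 1 represents row i among the rows 1, …, d; it is the only summand that changes, and
  -- passes from class m to class m + 1.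
  obtain ⟨p, hp⟩ := exists_fin_dvd d (i - 1)
  have hp' : (d : ℤ) ∣ p + 1 - i := by
    rw [show (p : ℤ) + 1 - i = -(i - 1 - p) by ring]
    exact hp.neg_right
  have hne : ∀ q : Fin d, q ≠ p → ¬ (d : ℤ) ∣ q + 1 - i := fun q hq h1 => by
    refine hq ((fin_dvd_iff q p).1 ?_)
    rw [show (q : ℤ) - p = q + 1 - i - (p + 1 - i) by ring]
    exact dvd_sub h1 hp'
  have h0 : (L : ℤ) ∣ lam.row (p + 1) + t - m := by
    rw [show lam.row (p + 1) + t - m = lam.row (p + 1) - lam.row i + (lam.row i + t - m) by ring]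
    exact dvd_add (lam.row_dvd hp') hm
  have h1 : (L : ℤ) ∣ k - (m + 1) ↔ (L : ℤ) ∣ lam.row (p + 1) + 1 + t - k := by
    rw [show lam.row (p + 1) + 1 + t - k = lam.row (p + 1) + t - m - (k - (m + 1)) by ring,
      dvd_sub_right h0]
  have h2 : (L : ℤ) ∣ k - m ↔ (L : ℤ) ∣ lam.row (p + 1) + t - k := by
    rw [show lam.row (p + 1) + t - k = lam.row (p + 1) + t - m - (k - m) by ring,
      dvd_sub_right h0]
  simp only [residueMap]
  push_cast
  rw [← Finset.sum_sub_distrib, Finset.sum_eq_single p]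
  · rw [h, if_pos hp', simpStep_apply]
    simp only [h1, h2]
  · intro q _ hq
    rw [h, if_neg (hne q hq), add_zero, sub_self]
  · simp

/-- The topmost row of a given length is addable. It exists since row i - d is longer than row i by
L > 0. -/
theorem CylShape.exists_addable {d L : ℕ} [NeZero L] (lam : CylShape d L) (i : ℤ) :
    ∃ j, lam.row j = lam.row i ∧ lam.Addable j := by
  have hL : 0 < L := Nat.pos_of_ne_zero (NeZero.ne L)
  have hp := lam.periodic (i - d)
  rw [sub_add_cancel] at hp
  obtain ⟨j, hj, hmin⟩ := Int.exists_least_of_bdd (P := fun z => lam.row z = lam.row i)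
    ⟨i - d, fun z hz => by
      by_contra hlt
      have := lam.anti (show z ≤ i - d by omega)
      omega⟩ ⟨i, rfl⟩
  refine ⟨j, hj, lt_of_le_of_ne (lam.anti (by omega)) fun h => ?_⟩
  have := hmin (j - 1) (h ▸ hj)
  omega

theorem CylShape.Addable.eq {d L : ℕ} {lam : CylShape d L} {i j : ℤ} (hi : lam.Addable i)
    (hj : lam.Addable j) (h : lam.row i = lam.row j) : i = j := by
  unfold Addable at hi hj
  rcases lt_trichotomy i j with h1 | h1 | h1
  · have := lam.anti (show i ≤ j - 1 by omega)
    omega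
  · exact h1
  · have := lam.anti (show j ≤ i - 1 by omega)
    omega

theorem CylShape.Addable.add_mul {d L : ℕ} {lam : CylShape d L} {i : ℤ} (hi : lam.Addable i)
    (c : ℤ) : lam.Addable (i + c * d) := by
  unfold Addable at *
  rw [show i + c * d - 1 = i - 1 + c * d by ring, row_add_mul, row_add_mul]
  omega

/-- Rows with lengths congruent modulo L have translates of equal length, and among rows of equal
length only the topmost is addable. Hence the possible additions correspond to the residues that
occur. -/
theorem residueMap_isCovering (d L : ℕ) [NeZero d] [NeZero L] (t : ℤ) :
    IsCovering (shapeGraph d L) (simpGraph L d) (residueMap t) where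
  map := by
    rintro u v ⟨i, hi⟩
    obtain ⟨m, hm⟩ := exists_fin_dvd L (u.row i + t)
    exact ⟨m, residueMap_sub hi hm⟩
  inj := by
    rintro u v v' ⟨i, hi⟩ ⟨j, hj⟩ h
    obtain ⟨m, hm⟩ := exists_fin_dvd L (u.row i + t)
    obtain ⟨m', hm'⟩ := exists_fin_dvd L (u.row j + t)
    have h1 := residueMap_sub hi hm
    rw [h, residueMap_sub hj hm'] at h1
    rw [simpStep_injective h1] at hm'
    obtain ⟨c, hc⟩ := dvd_sub hm hm'
    have h2 : i = j + (-c) * d := by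
      refine hi.addable.eq (hj.addable.add_mul (-c)) ?_
      rw [CylShape.row_add_mul]
      linarith
    exact hi.eq_of_dvd hj ⟨-c, by rw [h2]; ring⟩
  surj := by
    rintro u w ⟨m, hm⟩
    have hpos : 0 < (residueMap t u).1 m := by
      by_cases hL : (L : ℤ) ∣ 1
      · have h1 : ∀ a : ℤ, (L : ℤ) ∣ a := fun a => hL.trans (one_dvd a)
        have hd : 0 < d := Nat.pos_of_ne_zero (NeZero.ne d)
        simpa [residueMap, h1] using hd
      · exact pos_of_sub_eq_simpStep hL hm
    have hne : (∑ i : Fin d, if (L : ℤ) ∣ u.row (i + 1) + t - m then 1 else 0) ≠ 0 := hpos.ne'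
    obtain ⟨i, -, hi⟩ := Finset.exists_ne_zero_of_sum_ne_zero hne
    have hi' : (L : ℤ) ∣ u.row (i + 1) + t - m := by
      by_contra h
      exact hi (if_neg h)
    obtain ⟨j, hj, hadd⟩ := u.exists_addable (i + 1)
    rw [← hj] at hi'
    have h' := u.addsCell_addCell _ hadd
    exact ⟨_, ⟨_, h'⟩, Simp.ext_of_sub (residueMap_sub h' hi') hm⟩

theorem residueMap_rect (d L : ℕ) [NeZero d] [NeZero L] (i : Fin L) :
    residueMap (i : ℤ) (CylShape.rect d L) = corner L d i := by
  apply eq_corner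
  have h : ∀ k : Fin d, (CylShape.rect d L).row (k + 1) = 0 := fun k =>
    CylShape.rect_row d L _ (by omega) (by omega)
  simp [residueMap, h]

/-! ### Particle configurations -/

namespace CylShape

variable {d L : ℕ}

/-- The site of the particle that corresponds to row `i`. -/
def site (lam : CylShape d L) (i : ℤ) : ZMod (d + L) := ((i - lam.row i : ℤ) : ZMod (d + L))

theorem lt_of_sub_row_lt (lam : CylShape d L) {i j : ℤ}
    (h : i - lam.row i < j - lam.row j) : i < j := by
  by_contra hij
  have := lam.anti (not_lt.1 hij)
  omega

/-- Shifting the row index by d changes `i - lam.row i` by d + L, so every integer representing a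
site is attained. -/
theorem exists_of_site_eq (lam : CylShape d L) {k a : ℤ}
    (h : lam.site k = ((a : ℤ) : ZMod (d + L))) :
    ∃ k', (d : ℤ) ∣ k' - k ∧ k' - lam.row k' = a := by
  rw [site, ZMod.intCast_eq_intCast_iff_dvd_sub] at h
  obtain ⟨c, hc⟩ := h
  refine ⟨k + c * d, ⟨c, by ring⟩, ?_⟩
  rw [row_add_mul]
  push_cast at hc
  linarith

theorem site_eq_iff (lam : CylShape d L) {i j : ℤ} :
    lam.site i = lam.site j ↔ (d : ℤ) ∣ i - j := by
  constructor
  · intro h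
    obtain ⟨k, hk, hk'⟩ := lam.exists_of_site_eq h
    have : k = j := by
      rcases lt_trichotomy k j with h1 | h1 | h1
      · have := lam.anti h1.le
        omega
      · exact h1
      · have := lam.anti h1.le
        omega
    subst this
    rw [← dvd_neg, neg_sub]
    exact hk
  · rintro ⟨c, hc⟩
    have := lam.row_add_mul j c
    rw [show j + c * d = i by linarith] at this
    rw [site, site, ZMod.intCast_eq_intCast_iff_dvd_sub, this]
    exact ⟨-c, by push_cast; linarith⟩

theorem AddsCell.site_eq {lam lam' : CylShape d L} {i k : ℤ} (h : lam.AddsCell lam' i) :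
    lam'.site k = lam.site k - if (d : ℤ) ∣ k - i then 1 else 0 := by
  rw [site, site, h k]
  split_ifs <;> push_cast <;> ring

/-- A particle just before that of row i would belong to a row above i; such rows are strictly
longer, which puts their particles at least two places back. -/
theorem Addable.site_ne {lam : CylShape d L} {i : ℤ} (h : lam.Addable i) (k : ℤ) :
    lam.site k ≠ lam.site i - 1 := by
  intro hk
  obtain ⟨k', -, hk'⟩ := lam.exists_of_site_eq (k := k) (a := i - lam.row i - 1)
    (by rw [hk, site]; push_cast; ring)
  have h1 := lam.lt_of_sub_row_lt (show k' - lam.row k' < i - lam.row i by omega)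
  have h2 := lam.anti (show k' ≤ i - 1 by omega)
  unfold Addable at h
  omega

end CylShape

/-- The particle configuration of a cylindric shape. -/
noncomputable def particleMap {d L : ℕ} [NeZero d] (lam : CylShape d L) : TState d L := by
  classical
  exact ⟨fun r => decide (∃ i, lam.site i = r), by
    have h : {r | decide (∃ i, lam.site i = r) = true} =
        (fun i : Fin d => lam.site i) '' Set.univ := by
      ext r
      simp only [decide_eq_true_eq, Set.mem_ofPred_eq, Set.image_univ, Set.mem_range]
      constructor
      · rintro ⟨i, rfl⟩
        obtain ⟨m, hm⟩ := exists_fin_dvd d i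
        exact ⟨m, (lam.site_eq_iff.2 hm).symm⟩
      · rintro ⟨i, rfl⟩
        exact ⟨i, rfl⟩
    rw [h, Set.ncard_image_of_injective, Set.ncard_univ, Nat.card_fin]
    intro i j hij
    exact (fin_dvd_iff i j).1 (lam.site_eq_iff.1 hij)⟩

theorem particleMap_eq_true {d L : ℕ} [NeZero d] {lam : CylShape d L} {r : ZMod (d + L)} :
    (particleMap lam).1 r = true ↔ ∃ i, lam.site i = r := by
  simp [particleMap]

theorem particleMap_eq_false {d L : ℕ} [NeZero d] {lam : CylShape d L} {r : ZMod (d + L)} :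
    (particleMap lam).1 r = false ↔ ∀ i, lam.site i ≠ r := by
  simp [particleMap]

theorem particleMap_jump {d L : ℕ} [NeZero d] [NeZero L] {lam lam' : CylShape d L} {i : ℤ}
    (h : lam.AddsCell lam' i) :
    ((particleMap lam).1 (lam.site i - 1) = false ∧ (particleMap lam).1 (lam.site i) = true) ∧
    ((particleMap lam').1 (lam.site i - 1) = true ∧ (particleMap lam').1 (lam.site i) = false) ∧
      ∀ t, t ≠ lam.site i - 1 → t ≠ lam.site i →
        (particleMap lam).1 t = (particleMap lam').1 t := by
  -- Two sites are needed for a site to differ from its predecessor.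
  have hN : Fact (1 < d + L) := ⟨by
    have := Nat.pos_of_ne_zero (NeZero.ne d)
    have := Nat.pos_of_ne_zero (NeZero.ne L)
    omega⟩
  simp only [particleMap_eq_false, particleMap_eq_true]
  refine ⟨⟨fun k => h.addable.site_ne k, i, rfl⟩, ⟨⟨i, by rw [h.site_eq]; simp⟩, fun k hk => ?_⟩,
    fun t h1 h2 => ?_⟩
  · rw [h.site_eq] at hk
    split_ifs at hk with hd
    · rw [lam.site_eq_iff.2 hd] at hk
      simp at hk
    · rw [sub_zero, lam.site_eq_iff] at hk
      exact hd hk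
  · rw [Bool.eq_iff_iff, particleMap_eq_true, particleMap_eq_true]
    refine exists_congr fun k => ?_
    rw [h.site_eq]
    split_ifs with hd
    · rw [lam.site_eq_iff.2 hd]
      exact ⟨fun h => (h2 h.symm).elim, fun h => (h1 h.symm).elim⟩
    · rw [sub_zero]

theorem particleMap_isCovering (d L : ℕ) [NeZero d] [NeZero L] :
    IsCovering (shapeGraph d L) (tasepGraph d L) particleMap where
  map := by
    rintro u v ⟨i, hi⟩
    exact ⟨u.site i, particleMap_jump hi⟩
  inj := by
    rintro u v v' ⟨i, hi⟩ ⟨j, hj⟩ h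
    refine hi.eq_of_dvd hj ?_
    by_contra hd
    have h1 := (particleMap_jump hi).2.1.2
    rw [h, particleMap_eq_false] at h1
    refine h1 i ?_
    rw [hj.site_eq, if_neg hd, sub_zero]
  surj := by
    rintro u w ⟨r, ⟨h1, h2⟩, ⟨h3, h4⟩, h5⟩
    obtain ⟨i, rfl⟩ := particleMap_eq_true.1 h2
    -- If row i - 1 had the length of row i, its particle would occupy the site just before.
    have hadd : u.Addable i := by
      refine lt_of_le_of_ne (u.anti (by omega)) fun h => ?_
      refine particleMap_eq_false.1 h1 (i - 1) ?_
      rw [CylShape.site, CylShape.site, ← h]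
      push_cast
      ring
    have h' := u.addsCell_addCell _ hadd
    obtain ⟨-, ⟨h6, h7⟩, h8⟩ := particleMap_jump h'
    refine ⟨_, ⟨_, h'⟩, Subtype.ext (funext fun t => ?_)⟩
    by_cases ht1 : t = u.site i - 1
    · rw [ht1, h6, h3]
    · by_cases ht2 : t = u.site i
      · rw [ht2, h7, h4]
      · rw [← h8 t ht1 ht2, h5 t ht1 ht2]

theorem particleMap_rect (d L : ℕ) [NeZero d] :
    particleMap (CylShape.rect d L) = blockState d L := by
  have hs : ∀ k : ℤ, 1 ≤ k → k ≤ d → (CylShape.rect d L).site k = (k : ZMod (d + L)) := by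
    intro k h1 h2
    rw [CylShape.site, CylShape.rect_row d L k h1 h2, sub_zero]
  apply Subtype.ext
  funext r
  rw [Bool.eq_iff_iff, particleMap_eq_true]
  simp only [blockState, decide_eq_true_eq]
  constructor
  · rintro ⟨i, rfl⟩
    obtain ⟨m, hm⟩ := exists_fin_dvd d (i - 1)
    refine ⟨m + 1, by omega, by omega, ?_⟩
    rw [(CylShape.rect d L).site_eq_iff.2 (show (d : ℤ) ∣ i - (m + 1) by
      rwa [show i - ((m : ℤ) + 1) = i - 1 - m by ring]), hs _ (by omega) (by omega)]
    push_cast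
    rfl
  · rintro ⟨k, h1, h2, rfl⟩
    exact ⟨k, by rw [hs k (by omega) (by omega)]; push_cast; rfl⟩


/-! ### Cells -/

section Cells

variable {d L : ℕ}

theorem cell_eq_iff {i j i' j' : ℤ} :
    cell d L i j = cell d L i' j' ↔ ∃ k : ℤ, i' = i - k * d ∧ j' = j + k * L := by
  rw [cell, cell, QuotientAddGroup.eq, AddSubgroup.mem_zmultiples_iff]
  refine exists_congr fun k => ?_
  simp only [Prod.ext_iff, Prod.smul_fst, Prod.smul_snd, Prod.fst_add, Prod.snd_add,
    Prod.fst_neg, Prod.snd_neg, smul_eq_mul]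
  constructor <;> rintro ⟨h1, h2⟩ <;> constructor <;> linarith

theorem exists_cell_eq (c : Cylinder d L) : ∃ i j, c = cell d L i j := by
  obtain ⟨⟨i, j⟩, rfl⟩ := QuotientAddGroup.mk_surjective c
  exact ⟨i, j, rfl⟩

theorem cell_mem_diagram (lam : CylShape d L) {i j : ℤ} :
    cell d L i j ∈ lam.diagram ↔ j ≤ lam.row i := by
  constructor
  · rintro ⟨i', j', h, h'⟩
    obtain ⟨k, rfl, rfl⟩ := cell_eq_iff.1 h
    have := lam.row_add_mul i (-k)
    rw [show i + -k * (d : ℤ) = i - k * d by ring] at this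
    linarith
  · intro h
    exact ⟨i, j, rfl, h⟩

theorem cell_mem_skewDiagram (lam μ : CylShape d L) {i j : ℤ} :
    cell d L i j ∈ lam.skewDiagram μ ↔ j ≤ lam.row i ∧ μ.row i < j := by
  rw [CylShape.skewDiagram, Set.mem_sdiff, cell_mem_diagram, cell_mem_diagram, not_le]

theorem cell_eq_addable_iff (μ : CylShape d L) {i k j : ℤ} :
    cell d L k j = cell d L i (μ.row i + 1) ↔ (d : ℤ) ∣ k - i ∧ j = μ.row k + 1 := by
  rw [cell_eq_iff]
  constructor
  · rintro ⟨c, rfl, h⟩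
    have := μ.row_add_mul k (-c)
    rw [show k + -c * (d : ℤ) = k - c * d by ring] at this
    exact ⟨⟨c, by ring⟩, by linarith⟩
  · rintro ⟨⟨c, hc⟩, rfl⟩
    have := μ.row_add_mul k (-c)
    rw [show k + -c * (d : ℤ) = i by linarith] at this
    exact ⟨c, by linarith, by linarith⟩

theorem CylShape.AddsCell.mem_skewDiagram_iff {μ ν : CylShape d L} {i : ℤ}
    (h : μ.AddsCell ν i) (lam : CylShape d L) (c : Cylinder d L) :
    c ∈ lam.skewDiagram ν ↔ c ∈ lam.skewDiagram μ ∧ c ≠ cell d L i (μ.row i + 1) := by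
  obtain ⟨k, j, rfl⟩ := exists_cell_eq c
  rw [cell_mem_skewDiagram, cell_mem_skewDiagram, Ne, cell_eq_addable_iff, h k]
  split_ifs with hd
  · simp only [hd, true_and]
    omega
  · simp [hd]

theorem CylShape.AddsCell.le {μ ν : CylShape d L} {i : ℤ} (h : μ.AddsCell ν i) : μ ≤ ν := by
  intro k
  rw [h k]
  split_ifs <;> omega

theorem CylShape.le_trans {lam μ ν : CylShape d L} (h : lam ≤ μ) (h' : μ ≤ ν) : lam ≤ ν :=
  fun k => (h k).trans (h' k)

theorem CylShape.AddsCell.mem_skewDiagram {μ ν lam : CylShape d L} {i : ℤ}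
    (h : μ.AddsCell ν i) (hle : ν ≤ lam) :
    cell d L i (μ.row i + 1) ∈ lam.skewDiagram μ := by
  rw [cell_mem_skewDiagram]
  have h1 := hle i
  rw [h i, if_pos (by simp)] at h1
  omega

end Cells

/-! ### Tableaux as walks -/

/-- `E` is the filling of a standard cylindric tableau of shape `lam/μ` with `n` cells,
extended by zero to the cylinder. -/
structure IsTableau {d L : ℕ} (μ : CylShape d L) (n : ℕ) (lam : CylShape d L)
    (E : Cylinder d L → ℕ) : Prop where
  le : μ ≤ lam
  bij : Set.BijOn E (lam.skewDiagram μ) (Set.Icc 1 n)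
  zero : ∀ c, c ∉ lam.skewDiagram μ → E c = 0
  col_lt : ∀ i j, cell d L i j ∈ lam.skewDiagram μ → cell d L (i + 1) j ∈ lam.skewDiagram μ →
    E (cell d L i j) < E (cell d L (i + 1) j)
  row_lt : ∀ i j, cell d L i j ∈ lam.skewDiagram μ → cell d L i (j + 1) ∈ lam.skewDiagram μ →
    E (cell d L i j) < E (cell d L i (j + 1))

/-- The pairs of an outer shape and a filling that make up a tableau of inner shape `μ`. -/
abbrev Tableau {d L : ℕ} (μ : CylShape d L) (n : ℕ) : Type :=
  {p : CylShape d L × (Cylinder d L → ℕ) // IsTableau μ n p.1 p.2}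

theorem SCT.ext_entry {d L : ℕ} {lam μ : CylShape d L} {S T : SCT lam μ}
    (h : ∀ c, S.entry c = T.entry c) : S = T := by
  cases S
  cases T
  congr
  exact funext h

/-- Entries are positive, so extension by zero loses nothing; it frees the filling from a domain
that depends on the shape. -/
theorem sctInner_equiv_tableau {d L : ℕ} (μ : CylShape d L) (n : ℕ) :
    Nonempty (SCTInner μ n ≃ Tableau μ n) := by
  classical
  let ext (lam : CylShape d L) (T : SCT lam μ) : Cylinder d L → ℕ :=
    fun c => if h : c ∈ lam.skewDiagram μ then T.entry ⟨c, h⟩ else 0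
  have hext : ∀ lam T c (h : c ∈ lam.skewDiagram μ), ext lam T c = T.entry ⟨c, h⟩ :=
    fun lam T c h => dif_pos h
  refine ⟨Equiv.ofBijective (fun p => ⟨(p.1.1, ext p.1.1 p.2), ?_⟩) ⟨?_, ?_⟩⟩
  · obtain ⟨⟨lam, hle, hfin, hcard⟩, T⟩ := p
    have hI : Set.Icc 1 (lam.skewDiagram μ).ncard = Set.Icc 1 n := by rw [hcard]
    have hbij : Set.BijOn T.entry Set.univ (Set.Icc 1 (lam.skewDiagram μ).ncard) := T.bij
    rw [hI] at hbij
    change IsTableau μ n lam (ext lam T)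
    refine ⟨hle, ⟨fun c hc => ?_, fun c hc c' hc' h => ?_, fun m hm => ?_⟩, fun c hc => dif_neg hc,
      fun i j h h' => ?_, fun i j h h' => ?_⟩
    · rw [hext _ _ _ hc]
      exact hbij.mapsTo (Set.mem_univ _)
    · rw [hext _ _ _ hc, hext _ _ _ hc'] at h
      exact congrArg Subtype.val (hbij.injOn (Set.mem_univ _) (Set.mem_univ _) h)
    · obtain ⟨⟨c, hc⟩, -, h⟩ := hbij.surjOn hm
      exact ⟨c, hc, (hext _ _ _ hc).trans h⟩
    · rw [hext _ _ _ h, hext _ _ _ h']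
      exact T.col_lt i j h h'
    · rw [hext _ _ _ h, hext _ _ _ h']
      exact T.row_lt i j h h'
  · rintro ⟨⟨lam, h⟩, T⟩ ⟨⟨lam', h'⟩, T'⟩ heq
    have h1 := Prod.ext_iff.1 (congrArg Subtype.val heq)
    obtain rfl : lam = lam' := h1.1
    have h2 : ext lam T = ext lam T' := h1.2
    refine Sigma.ext rfl (heq_of_eq (SCT.ext_entry fun c => ?_))
    rw [← hext lam T c.1 c.2, h2, hext lam T' c.1 c.2]
  · rintro ⟨⟨lam, E⟩, h⟩
    have hcard : (lam.skewDiagram μ).ncard = n := by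
      rw [← h.bij.injOn.ncard_image, h.bij.image_eq]
      simp [Set.ncard_eq_toFinset_card']
    have hI : Set.Icc 1 (lam.skewDiagram μ).ncard = Set.Icc 1 n := by rw [hcard]
    have hfin : (lam.skewDiagram μ).Finite := by
      refine Set.Finite.of_finite_image ?_ h.bij.injOn
      rw [h.bij.image_eq]
      exact Set.finite_Icc 1 n
    refine ⟨⟨⟨lam, h.le, hfin, hcard⟩, ⟨fun c => E c.1, ⟨fun c _ => ?_, fun c _ c' _ hcc => ?_,
      fun m hm => ?_⟩, h.col_lt, h.row_lt⟩⟩, ?_⟩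
    · change E c.1 ∈ Set.Icc 1 (lam.skewDiagram μ).ncard
      rw [hI]
      exact h.bij.mapsTo c.2
    · exact Subtype.ext (h.bij.injOn c.2 c'.2 hcc)
    · change m ∈ Set.Icc 1 (lam.skewDiagram μ).ncard at hm
      rw [hI] at hm
      obtain ⟨c, hc, h'⟩ := h.bij.surjOn hm
      exact ⟨⟨c, hc⟩, Set.mem_univ _, h'⟩
    · refine Subtype.ext (Prod.ext rfl (funext fun c => ?_))
      by_cases hc : c ∈ lam.skewDiagram μ
      · exact dif_pos hc
      · exact (dif_neg hc).trans (h.zero c hc).symm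

/-! ### Adding and removing the first cell -/

namespace IsTableau

variable {d L : ℕ} {μ ν lam : CylShape d L} {n : ℕ} {E : Cylinder d L → ℕ}

theorem one_le (h : IsTableau μ n lam E) {c : Cylinder d L} (hc : c ∈ lam.skewDiagram μ) :
    1 ≤ E c := (h.bij.mapsTo hc).1

theorem mem_of_ne_zero (h : IsTableau μ n lam E) {c : Cylinder d L} (hc : E c ≠ 0) :
    c ∈ lam.skewDiagram μ := by
  by_contra h'
  exact hc (h.zero c h')

open Classical in
/-- Adding to a tableau a new first cell. -/
theorem cons [NeZero L] (h : IsTableau ν n lam E) {i : ℤ} (hi : μ.AddsCell ν i) :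
    IsTableau μ (n + 1) lam (fun c => if c ∈ lam.skewDiagram μ then E c + 1 else 0) := by
  have hadd := hi.addable
  unfold CylShape.Addable at hadd
  have hmem := hi.mem_skewDiagram_iff lam
  have hc0 := hi.mem_skewDiagram h.le
  have hE0 : E (cell d L i (μ.row i + 1)) = 0 := h.zero _ fun hc => ((hmem _).1 hc).2 rfl
  -- The new cell has value 0 under `E`, below all entries of lam/ν, so only the larger cell must be
  -- known to lie in lam/ν.
  have hlt : ∀ c c', c' ∈ lam.skewDiagram ν → c ∈ lam.skewDiagram μ →
      (c ∈ lam.skewDiagram ν → E c < E c') → E c + 1 < E c' + 1 := by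
    intro c c' hc' hc hcc
    by_cases hcν : c ∈ lam.skewDiagram ν
    · exact Nat.succ_lt_succ (hcc hcν)
    · rw [h.zero c hcν]
      exact Nat.succ_lt_succ (h.one_le hc')
  refine ⟨CylShape.le_trans hi.le h.le, ⟨fun c hc => ?_, fun c hc c' hc' hcc => ?_, fun m hm => ?_⟩,
    fun c hc => if_neg hc, fun k j hc hc' => ?_, fun k j hc hc' => ?_⟩
  · simp only [if_pos hc]
    refine ⟨by omega, ?_⟩
    by_cases hcν : c ∈ lam.skewDiagram ν
    · exact Nat.succ_le_succ (h.bij.mapsTo hcν).2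
    · rw [h.zero c hcν]
      omega
  · simp only [if_pos hc, if_pos hc', add_left_inj] at hcc
    by_cases hcν : c ∈ lam.skewDiagram ν
    · have h1 := h.one_le hcν
      exact h.bij.injOn hcν (h.mem_of_ne_zero (by omega)) hcc
    · have h1 : c' ∉ lam.skewDiagram ν := fun hcν' => by
        have := h.one_le hcν'
        rw [h.zero c hcν] at hcc
        omega
      rw [hmem, not_and, not_not] at h1 hcν
      rw [h1 hc', hcν hc]
  · obtain ⟨hm1, hm2⟩ := hm
    by_cases hm' : m = 1
    · refine ⟨_, hc0, ?_⟩
      simp only [if_pos hc0, hE0, hm']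
    · obtain ⟨c, hc, hcm⟩ := h.bij.surjOn (show m - 1 ∈ Set.Icc 1 n from ⟨by omega, by omega⟩)
      refine ⟨c, ((hmem c).1 hc).1, ?_⟩
      simp only [if_pos ((hmem c).1 hc).1]
      omega
  · simp only [if_pos hc, if_pos hc']
    refine hlt _ _ ((hmem _).2 ⟨hc', fun heq => ?_⟩) hc fun hcν => h.col_lt k j hcν
      ((hmem _).2 ⟨hc', fun heq => ?_⟩)
    -- If the lower cell were the new one, the cell above it would lie in μ, because row i of μ is
    -- shorter than row i - 1.
    all_goals
      rw [cell_eq_addable_iff] at heq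
      obtain ⟨⟨a, ha⟩, hj⟩ := heq
      rw [cell_mem_skewDiagram] at hc
      have h1 := μ.row_add_mul i a
      have h2 := μ.row_add_mul (i - 1) a
      rw [show i + a * d = k + 1 by linarith] at h1
      rw [show i - 1 + a * d = k by linarith] at h2
      omega
  · simp only [if_pos hc, if_pos hc']
    refine hlt _ _ ((hmem _).2 ⟨hc', fun heq => ?_⟩) hc fun hcν => h.row_lt k j hcν
      ((hmem _).2 ⟨hc', fun heq => ?_⟩)
    all_goals
      rw [cell_eq_addable_iff] at heq
      rw [cell_mem_skewDiagram] at hc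
      omega

/-- The first cell of a tableau can be added to the inner shape. -/
theorem exists_first (h : IsTableau μ (n + 1) lam E) :
    ∃ i, μ.Addable i ∧ E (cell d L i (μ.row i + 1)) = 1 := by
  obtain ⟨c, hc, hc1⟩ := h.bij.surjOn (show 1 ∈ Set.Icc 1 (n + 1) from ⟨le_rfl, by omega⟩)
  obtain ⟨i, j, rfl⟩ := exists_cell_eq c
  have hc' := hc
  rw [cell_mem_skewDiagram] at hc'
  have hj : j = μ.row i + 1 := by
    by_contra hne
    have hm : cell d L i (j - 1) ∈ lam.skewDiagram μ := by
      rw [cell_mem_skewDiagram]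
      omega
    have h1 := h.row_lt i (j - 1) hm (by rwa [sub_add_cancel])
    rw [sub_add_cancel] at h1
    have h2 := h.one_le hm
    omega
  refine ⟨i, ?_, hj ▸ hc1⟩
  by_contra hadd
  -- Were row i not addable, the cell above would lie in lam/μ with a positive entry less than 1.
  have hm : cell d L (i - 1) j ∈ lam.skewDiagram μ := by
    rw [cell_mem_skewDiagram]
    have := lam.anti (show i - 1 ≤ i by omega)
    unfold CylShape.Addable at hadd
    omega
  have h1 := h.col_lt (i - 1) j hm (by rwa [sub_add_cancel])
  rw [sub_add_cancel] at h1
  have h2 := h.one_le hm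
  omega

/-- Removing the first cell of a tableau. -/
theorem tail (h : IsTableau μ (n + 1) lam E) {i : ℤ} (hi : μ.AddsCell ν i)
    (h1 : E (cell d L i (μ.row i + 1)) = 1) : IsTableau ν n lam (fun c => E c - 1) := by
  have hmem := hi.mem_skewDiagram_iff lam
  have hc0 : cell d L i (μ.row i + 1) ∈ lam.skewDiagram μ := h.mem_of_ne_zero (by omega)
  -- Truncated subtraction is therefore faithful on lam/ν, while the removed cell gets the default
  -- value 0.
  have hlt : ∀ {c}, c ∈ lam.skewDiagram ν → 2 ≤ E c := by
    intro c hc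
    obtain ⟨hc, hne⟩ := (hmem c).1 hc
    have h2 := h.one_le hc
    by_contra hlt
    exact hne (h.bij.injOn hc hc0 (by omega))
  refine ⟨fun k => ?_, ⟨fun c hc => ?_, fun c hc c' hc' hcc => ?_, fun m hm => ?_⟩,
    fun c hc => ?_, fun k j hc hc' => ?_, fun k j hc hc' => ?_⟩
  · rw [hi k]
    split_ifs with hd
    · rw [← (cell_eq_addable_iff μ).2 ⟨hd, rfl⟩, cell_mem_skewDiagram] at hc0
      exact hc0.1
    · rw [add_zero]
      exact h.le k
  · have h2 := hlt hc
    have h3 := (h.bij.mapsTo ((hmem c).1 hc).1).2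
    change 1 ≤ E c - 1 ∧ E c - 1 ≤ n
    omega
  · have h2 := hlt hc
    have h3 := hlt hc'
    simp only at hcc
    exact h.bij.injOn ((hmem c).1 hc).1 ((hmem c').1 hc').1 (by omega)
  · obtain ⟨hm1, hm2⟩ := hm
    obtain ⟨c, hc, hcm⟩ := h.bij.surjOn (show m + 1 ∈ Set.Icc 1 (n + 1) from ⟨by omega, by omega⟩)
    refine ⟨c, (hmem c).2 ⟨hc, ?_⟩, by simp only; omega⟩
    rintro rfl
    omega
  · by_cases hcμ : c ∈ lam.skewDiagram μ
    · rw [hmem, not_and, not_not] at hc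
      rw [hc hcμ, h1]
    · rw [h.zero c hcμ]
  · have h2 := hlt hc
    have h3 := h.col_lt k j ((hmem _).1 hc).1 ((hmem _).1 hc').1
    omega
  · have h2 := hlt hc
    have h3 := h.row_lt k j ((hmem _).1 hc).1 ((hmem _).1 hc').1
    omega

end IsTableau

theorem tableau_succ_equiv {d L : ℕ} [NeZero d] [NeZero L] (μ : CylShape d L) (n : ℕ) :
    Nonempty (Tableau μ (n + 1) ≃ Σ ν : {ν // (shapeGraph d L).Adj μ ν}, Tableau ν.1 n) := by
  classical
  let f : (Σ ν : {ν // (shapeGraph d L).Adj μ ν}, Tableau ν.1 n) → Tableau μ (n + 1) :=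
    fun p => ⟨(p.2.1.1, fun c => if c ∈ p.2.1.1.skewDiagram μ then p.2.1.2 c + 1 else 0), by
      obtain ⟨⟨ν, i, hi⟩, ⟨⟨lam, E⟩, h⟩⟩ := p
      exact h.cons hi⟩
  refine ⟨(Equiv.ofBijective f ⟨?_, ?_⟩).symm⟩
  · rintro ⟨⟨ν, i, hi⟩, ⟨⟨lam, E⟩, h⟩⟩ ⟨⟨ν', i', hi'⟩, ⟨⟨lam', E'⟩, h'⟩⟩ heq
    have g : IsTableau ν n lam E := h
    have g' : IsTableau ν' n lam' E' := h'
    have h1 := Prod.ext_iff.1 (congrArg Subtype.val heq)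
    obtain rfl : lam = lam' := h1.1
    have h2 : ∀ c ∈ lam.skewDiagram μ, E c = E' c := fun c hc => by
      have h3 : (if c ∈ lam.skewDiagram μ then E c + 1 else 0) =
          if c ∈ lam.skewDiagram μ then E' c + 1 else 0 := congrFun h1.2 c
      rwa [if_pos hc, if_pos hc, add_left_inj] at h3
    have hcell : ∀ c, (c ∈ lam.skewDiagram μ → E c = E' c) → E c = E' c := fun c hc => by
      by_cases hcμ : c ∈ lam.skewDiagram μ
      · exact hc hcμ
      · rw [g.zero c fun hcν => hcμ ((hi.mem_skewDiagram_iff lam c).1 hcν).1,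
          g'.zero c fun hcν => hcμ ((hi'.mem_skewDiagram_iff lam c).1 hcν).1]
    -- The added cell is recovered as the cell of lam/μ on which the shorter filling vanishes.
    have h3 : cell d L i (μ.row i + 1) = cell d L i' (μ.row i' + 1) := by
      have hc := hi.mem_skewDiagram g.le
      have h4 : cell d L i (μ.row i + 1) ∉ lam.skewDiagram ν := fun hc' =>
        ((hi.mem_skewDiagram_iff lam _).1 hc').2 rfl
      by_contra hne
      have h5 := g'.one_le ((hi'.mem_skewDiagram_iff lam _).2 ⟨hc, hne⟩)
      rw [← h2 _ hc, g.zero _ h4] at h5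
      omega
    obtain rfl : ν = ν' := hi.eq_of_dvd hi' ((cell_eq_addable_iff μ).1 h3).1
    obtain rfl : E = E' := funext fun c => hcell c (h2 c)
    rfl
  · rintro ⟨⟨lam, E⟩, h⟩
    obtain ⟨i, hadd, h1⟩ := h.exists_first
    have hi := μ.addsCell_addCell i hadd
    refine ⟨⟨⟨_, i, hi⟩, ⟨(lam, fun c => E c - 1), h.tail hi h1⟩⟩, ?_⟩
    refine Subtype.ext (Prod.ext rfl (funext fun c => ?_))
    by_cases hc : c ∈ lam.skewDiagram μ
    · exact (if_pos hc).trans (Nat.sub_add_cancel (h.one_le hc))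
    · exact (if_neg hc).trans (h.zero c hc).symm

theorem tableau_zero_equiv {d L : ℕ} (μ : CylShape d L) : Nonempty (Tableau μ 0 ≃ Unit) := by
  have hempty : μ.skewDiagram μ = ∅ := Set.sdiff_self
  have h0 : IsTableau μ 0 μ fun _ => 0 := by
    refine ⟨fun _ => le_rfl, ?_, fun _ _ => rfl, fun i j h => ?_, fun i j h => ?_⟩
    · rw [hempty]
      simp
    all_goals
      rw [hempty] at h
      exact h.elim
  have huniq : ∀ p : Tableau μ 0, p = ⟨(μ, fun _ => 0), h0⟩ := by
    rintro ⟨⟨lam, E⟩, h⟩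
    have h1 : lam.skewDiagram μ = ∅ := by
      refine Set.eq_empty_of_forall_notMem fun c hc => ?_
      have := h.bij.mapsTo hc
      simp at this
    obtain rfl : lam = μ := by
      refine CylShape.ext_row fun k => le_antisymm ?_ (h.le k)
      by_contra hk
      have : cell d L k (lam.row k) ∈ lam.skewDiagram μ := by
        rw [cell_mem_skewDiagram]
        omega
      rw [h1] at this
      exact this
    obtain rfl : E = fun _ => 0 := funext fun c => h.zero c (by rw [h1]; exact fun h => h)
    rfl
  exact ⟨⟨fun _ => (), fun _ => ⟨(μ, fun _ => 0), h0⟩, fun p => (huniq p).symm, fun _ => rfl⟩⟩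

theorem tableau_equiv_walk {d L : ℕ} [NeZero d] [NeZero L] (n : ℕ) (μ : CylShape d L) :
    Nonempty (Tableau μ n ≃ DiWalk (shapeGraph d L) μ n) := by
  induction n generalizing μ with
  | zero =>
    obtain ⟨e⟩ := tableau_zero_equiv μ
    exact ⟨e.trans (DiWalk.zeroEquiv _ μ).symm⟩
  | succ n ih =>
    obtain ⟨e⟩ := tableau_succ_equiv μ n
    exact ⟨e.trans ((Equiv.sigmaCongrRight fun ν : {ν // (shapeGraph d L).Adj μ ν} =>
      (ih ν.1).some).trans (DiWalk.consEquiv _ μ n).symm)⟩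

theorem card_sctInner {d L : ℕ} [NeZero d] [NeZero L] (n : ℕ) (μ : CylShape d L) :
    ENat.card (SCTInner μ n) = ENat.card (DiWalk (shapeGraph d L) μ n) := by
  obtain ⟨e⟩ := sctInner_equiv_tableau μ n
  obtain ⟨e'⟩ := tableau_equiv_walk n μ
  exact ENat.card_congr (e.trans e')


/-! ### Walks in `Δ_{4,L}` and free fermions -/

theorem Simp.exists_step {d M : ℕ} (x : Simp d M) {i : Fin d} (hi : 0 < x.1 i) :
    ∃ y : Simp d M, (fun j => (y.1 j : ℤ) - (x.1 j : ℤ)) = simpStep i := by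
  have hnn : ∀ j, 0 ≤ (x.1 j : ℤ) + simpStep i j := by
    intro j
    simp only [simpStep, Pi.sub_apply, Pi.single_apply]
    by_cases h : j = i
    · subst h
      split_ifs <;> omega
    · split_ifs <;> omega
  refine ⟨⟨fun j => ((x.1 j : ℤ) + simpStep i j).toNat, ?_⟩, funext fun j => ?_⟩
  · zify
    simp only [Int.toNat_of_nonneg (hnn _)]
    rw [Finset.sum_add_distrib, ← Nat.cast_sum, x.2]
    simp [simpStep]
  · simp only [Int.toNat_of_nonneg (hnn _)]
    ring

instance (d M : ℕ) : Finite (Simp d M) := by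
  refine Finite.of_injective (fun x : Simp d M => fun i => (⟨x.1 i, Nat.lt_succ_of_le
    ((Finset.single_le_sum (f := x.1) (fun _ _ => Nat.zero_le _) (Finset.mem_univ i)).trans_eq
      x.2)⟩ : Fin (M + 1))) fun x y h => Subtype.ext (funext fun i => ?_)
  exact congrArg Fin.val (congrFun h i)

/-- Summation over out-neighbours in a simplex as a summation over steps. -/
theorem sum_simpGraph_adj {d M : ℕ} (hd : ¬(d : ℤ) ∣ 1) (x : Simp d M)
    [Fintype {v // (simpGraph d M).Adj x v}] (f : (Fin d → ℤ) → ℂ)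
    (hf : ∀ i, x.1 i = 0 → f (fun j => x.1 j + simpStep i j) = 0) :
    ∑ v : {v // (simpGraph d M).Adj x v}, f (fun j => v.1.1 j) =
      ∑ i, f (fun j => x.1 j + simpStep i j) := by
  choose y hy using fun (i : Fin d) (hi : 0 < x.1 i) => x.exists_step hi
  -- Steps out of a zero coordinate leave the simplex, but `f` vanishes where they land.
  rw [← Finset.sum_filter_of_ne (p := fun i => 0 < x.1 i)
    fun i _ h => Nat.pos_of_ne_zero fun h0 => h (hf i h0),
    Finset.sum_subtype (p := fun i => 0 < x.1 i) _ (by simp)]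
  symm
  refine Fintype.sum_bijective
    (fun i : {i // 0 < x.1 i} => (⟨y i.1 i.2, i.1, hy i.1 i.2⟩ : {v // (simpGraph d M).Adj x v}))
    ⟨fun i j h => ?_, ?_⟩ _ _ fun i => ?_
  · have h1 : y i.1 i.2 = y j.1 j.2 := congrArg Subtype.val h
    have h2 := hy i.1 i.2
    rw [h1, hy j.1 j.2] at h2
    exact Subtype.ext (simpStep_injective h2.symm)
  · rintro ⟨v, i, hi⟩
    exact ⟨⟨i, pos_of_sub_eq_simpStep hd hi⟩, Subtype.ext (Simp.ext_of_sub (hy i _) hi)⟩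
  · congr 1
    funext j
    have h := congrFun (hy i.1 i.2) j
    simp only at h ⊢
    omega

/-! ### Pfaffians for four particles on a cycle -/

section Pfaffian

variable {ι : Type*} (S : Finset ι) (z : ι → ℂ) (b : ι → ℤ → ℂ)

/-- A superposition of Pfaffian wave functions of four particles, in terms of their successive
distances. -/
def pfaffianSum (n : ℕ) (x y w : ℤ) : ℂ :=
  ∑ j ∈ S, ∑ k ∈ S, (z j + z k) ^ n *
    (b j x * b k w - b j (x + y) * b k (y + w) + b j (x + y + w) * b k y)

variable {S z b}

theorem sum_sum_eq_zero_of_antisymm {F : ι → ι → ℂ} (h : ∀ j ∈ S, ∀ k ∈ S, F j k = -F k j) :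
    ∑ j ∈ S, ∑ k ∈ S, F j k = 0 := by
  have h1 : ∑ j ∈ S, ∑ k ∈ S, F j k = -∑ j ∈ S, ∑ k ∈ S, F j k := by
    conv_rhs => rw [Finset.sum_comm]
    rw [← Finset.sum_neg_distrib]
    refine Finset.sum_congr rfl fun j hj => ?_
    rw [← Finset.sum_neg_distrib]
    exact Finset.sum_congr rfl fun k hk => h j hj k hk
  exact self_eq_neg.1 h1

/-- Moving one particle alters one factor of each pairing. The two ends of a pair change its
distance by +1 and -1, so a pair contributes its eigenvalue and the two pairs together `z j + z k`.
-/
theorem pfaffianSum_step (hrec : ∀ j ∈ S, ∀ m, b j (m + 1) + b j (m - 1) = z j * b j m)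
    (n : ℕ) (x y w : ℤ) :
    pfaffianSum S z b n (x + 1) y w + pfaffianSum S z b n (x - 1) (y + 1) w +
      pfaffianSum S z b n x (y - 1) (w + 1) + pfaffianSum S z b n x y (w - 1) =
    pfaffianSum S z b (n + 1) x y w := by
  simp only [pfaffianSum, ← Finset.sum_add_distrib]
  refine Finset.sum_congr rfl fun j hj => Finset.sum_congr rfl fun k hk => ?_
  rw [show x + 1 + y = x + y + 1 by ring, show x - 1 + (y + 1) = x + y by ring,
    show x + (y - 1) = x + y - 1 by ring, show x + y + 1 + w = x + y + w + 1 by ring,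
    show x + y - 1 + (w + 1) = x + y + w by ring, show y + 1 + w = y + w + 1 by ring,
    show y - 1 + (w + 1) = y + w by ring, show x + y + (w - 1) = x + y + w - 1 by ring,
    show y + (w - 1) = y + w - 1 by ring]
  have e1 := hrec j hj x
  have e2 := hrec j hj (x + y)
  have e3 := hrec j hj (x + y + w)
  have e4 := hrec k hk w
  have e5 := hrec k hk (y + w)
  have e6 := hrec k hk y
  rw [pow_succ]
  linear_combination (z j + z k) ^ n * (b k w * e1 + b j x * e4 - b k (y + w) * e2 -
    b j (x + y) * e5 + b k y * e3 + b j (x + y + w) * e6)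


end Pfaffian

/-- For y = 0 or w = 0 each summand vanishes. For x = 0, and by reflection when the outer particles
meet around the cycle, the summand is antisymmetric in j and k. -/
theorem pfaffianSum_boundary {ι : Type*} {S : Finset ι} {z : ι → ℂ} {b : ι → ℤ → ℂ} {N : ℤ}
    (hzero : ∀ j ∈ S, b j 0 = 0) (hrefl : ∀ j ∈ S, ∀ m, b j (N - m) = b j m) (n : ℕ) {x y w : ℤ}
    (h : x = 0 ∨ y = 0 ∨ w = 0 ∨ x + y + w = N) : pfaffianSum S z b n x y w = 0 := by
  refine sum_sum_eq_zero_of_antisymm fun j hj k hk => ?_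
  rcases h with rfl | rfl | rfl | h
  · rw [hzero j hj, hzero k hk, zero_add]
    ring
  · rw [hzero j hj, hzero k hk, zero_add, add_zero]
    ring
  · rw [hzero j hj, hzero k hk, add_zero, add_zero]
    ring
  · have hN : ∀ i ∈ S, b i N = 0 := fun i hi => by
      rw [← hrefl i hi N, sub_self, hzero i hi]
    rw [h, hN j hj, hN k hk, show x + y = N - w by omega, show y + w = N - x by omega,
      hrefl j hj, hrefl k hk, hrefl j hj, hrefl k hk]
    ring

theorem card_walk_eq_pfaffianSum {ι : Type*} {S : Finset ι} {z : ι → ℂ} {b : ι → ℤ → ℂ} {L : ℕ}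
    (hrec : ∀ j ∈ S, ∀ m, b j (m + 1) + b j (m - 1) = z j * b j m)
    (hzero : ∀ j ∈ S, b j 0 = 0)
    (hrefl : ∀ j ∈ S, ∀ m, b j ((L + 4 : ℕ) - m) = b j m)
    (hsum : ∀ m : ℤ, 0 < m → m < (L + 4 : ℕ) → ∑ j ∈ S, b j m = 1) (n : ℕ) (a : Simp 4 L) :
    (Nat.card (DiWalk (simpGraph 4 L) a n) : ℂ) =
      pfaffianSum S z b n (a.1 1 + 1) (a.1 2 + 1) (a.1 3 + 1) := by
  classical
  induction n generalizing a with
  | zero =>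
    have ha := a.2
    rw [Fin.sum_univ_four] at ha
    rw [DiWalk.card_zero]
    simp only [pfaffianSum, pow_zero, one_mul, Finset.sum_add_distrib, Finset.sum_sub_distrib,
      ← Finset.sum_mul_sum]
    push_cast at hsum
    -- All six distances lie strictly between 0 and L + 4, so the Pfaffian is 1 - 1 + 1.
    rw [hsum, hsum, hsum, hsum, hsum, hsum]
    · norm_num
    all_goals omega
  | succ n ih =>
    have := Fintype.ofFinite {v // (simpGraph 4 L).Adj a v}
    have ha := a.2
    rw [Fin.sum_univ_four] at ha
    rw [DiWalk.card_succ]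
    push_cast
    simp only [ih]
    have hs : ∀ i j : Fin 4, simpStep i j =
        (if j = i + 1 then 1 else 0) - (if j = i then 1 else 0) := by decide
    rw [sum_simpGraph_adj (by norm_num) a
      (fun v => pfaffianSum S z b n (v 1 + 1) (v 2 + 1) (v 3 + 1)), ← pfaffianSum_step hrec,
      Fin.sum_univ_four]
    · congr 1
      · congr 1
        · congr 1
          all_goals
            congr 1
            all_goals
              simp only [hs]
              simp
              try ring
        · congr 1
          all_goals
            simp only [hs]
            simp
            try ring
      · congr 1
        all_goals
          simp only [hs]
          simp
          try ring
    -- Distances exceed the coordinates by one, so a blocked step makes x, y or w zero for i = 1, 2,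
    -- 3, and x + y + w = L + 4 for i = 0.
    · intro i hi
      refine pfaffianSum_boundary hzero hrefl n ?_
      simp only [hs]
      fin_cases i <;> simp at hi ⊢ <;> omega


/-! ### Roots of unity -/

theorem zeta_isPrimitiveRoot (L : ℕ) : IsPrimitiveRoot (zeta L) (2 * (L + 4)) := by
  have h := Complex.isPrimitiveRoot_exp (2 * (L + 4)) (by omega)
  have h0 : ((L : ℂ) + 4) ≠ 0 := by exact_mod_cast (show L + 4 ≠ 0 by omega)
  have : zeta L = Complex.exp (2 * Real.pi * Complex.I / ((2 * (L + 4) : ℕ) : ℂ)) := by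
    rw [zeta]
    congr 1
    push_cast
    field_simp
  rwa [this]

theorem zeta_ne_zero (L : ℕ) : zeta L ≠ 0 := Complex.exp_ne_zero _

theorem zeta_pow_eq_neg_one (L : ℕ) : zeta L ^ (L + 4) = -1 := by
  have h0 : ((L : ℂ) + 4) ≠ 0 := by exact_mod_cast (show L + 4 ≠ 0 by omega)
  rw [zeta, ← Complex.exp_nat_mul, ← Complex.exp_pi_mul_I]
  congr 1
  push_cast
  field_simp

theorem zeta_pow_sq_ne_one (L : ℕ) {j : ℕ} (h0 : 0 < j) (h1 : j < L + 4) :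
    (zeta L ^ j) ^ 2 ≠ 1 := by
  rw [← pow_mul]
  exact (zeta_isPrimitiveRoot L).pow_ne_one_of_pos_of_lt (by omega) (by omega)

/-- The coefficients in the expansion of the sign function of a distance into modes. -/
noncomputable def modeCoeff (N q : ℂ) (m : ℤ) : ℂ :=
  (2 + (q + q⁻¹)) / N * ((q ^ m - q ^ (-m)) / (q - q⁻¹))

/-! ### Recursion, reflection and increments of the sine modes -/

section modeCoeff

variable {N q : ℂ}

theorem sub_inv_ne_zero_of_sq_ne_one (hq : q ≠ 0) (hq2 : q ^ 2 ≠ 1) : q - q⁻¹ ≠ 0 := by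
  intro h
  apply hq2
  field_simp at h
  linear_combination h

theorem modeCoeff_zero : modeCoeff N q 0 = 0 := by simp [modeCoeff]

theorem modeCoeff_one (hq : q ≠ 0) (hq2 : q ^ 2 ≠ 1) :
    modeCoeff N q 1 = (2 + (q + q⁻¹)) / N := by
  rw [modeCoeff, zpow_neg, zpow_one, div_self (sub_inv_ne_zero_of_sq_ne_one hq hq2), mul_one]

theorem modeCoeff_rec (hq : q ≠ 0) (m : ℤ) :
    modeCoeff N q (m + 1) + modeCoeff N q (m - 1) = (q + q⁻¹) * modeCoeff N q m := by
  simp only [modeCoeff, neg_add, neg_sub]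
  rw [sub_eq_add_neg m, show 1 - m = -m + 1 by ring, zpow_add₀ hq, zpow_add₀ hq, zpow_add₀ hq,
    zpow_add₀ hq, zpow_neg q 1, zpow_one]
  ring

theorem modeCoeff_refl {M : ℕ} (hq : q ≠ 0) (hM : q ^ M = -1) (m : ℤ) :
    modeCoeff N q (M - m) = modeCoeff N q m := by
  simp only [modeCoeff, neg_sub]
  rw [sub_eq_add_neg (M : ℤ), sub_eq_add_neg m, zpow_add₀ hq, zpow_add₀ hq, zpow_neg q M, zpow_natCast, hM,
    show (-1 : ℂ)⁻¹ = -1 by norm_num]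
  ring

/-- The prefactor 2 + q + q⁻¹ = (q + 1)²/q is what clears the denominator, turning increments of
sines into sums of two successive cosines. -/
theorem modeCoeff_add_one_sub (hq : q ≠ 0) (hq2 : q ^ 2 ≠ 1) (m : ℕ) :
    modeCoeff N q (m + 1) - modeCoeff N q m =
      1 / N * ((q ^ (m + 1) + (q ^ (m + 1))⁻¹) + (q ^ m + (q ^ m)⁻¹)) := by
  have h1 : q - 1 ≠ 0 := fun h => hq2 (by rw [sub_eq_zero.1 h]; norm_num)
  have h2 : q + 1 ≠ 0 := fun h => hq2 (by rw [eq_neg_of_add_eq_zero_left h]; norm_num)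
  have h3 : q - q⁻¹ = (q - 1) * (q + 1) / q := by
    field_simp
    ring
  have h4 : 2 + (q + q⁻¹) = (q + 1) ^ 2 / q := by
    field_simp
    ring
  simp only [modeCoeff]
  rw [zpow_neg, zpow_neg, zpow_add₀ hq, zpow_one, zpow_natCast, h3, h4, pow_succ]
  have h5 : q ^ m ≠ 0 := pow_ne_zero _ hq
  by_cases hN : N = 0
  · simp [hN]
  field_simp
  ring

end modeCoeff

/-! ### Sums over odd powers of ζ -/

theorem sum_odd_pow (w : ℂ) (hw : w ≠ 0) (M : ℕ) :
    (w - w⁻¹) * ∑ i ∈ Finset.range M, (w ^ (2 * i + 1) + (w ^ (2 * i + 1))⁻¹) =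
      w ^ (2 * M) - (w ^ (2 * M))⁻¹ := by
  induction M with
  | zero => simp
  | succ M ih =>
    rw [Finset.sum_range_succ, mul_add, ih, show 2 * (M + 1) = 2 * M + 1 + 1 by ring, pow_succ,
      pow_succ]
    have h : w ^ (2 * M) ≠ 0 := pow_ne_zero _ hw
    field_simp
    ring

/-- The odd numbers below `L + 4`. -/
def oddIndices (L : ℕ) : Finset ℕ := (Finset.Icc 1 (L + 3)).filter Odd

theorem mem_oddIndices {L j : ℕ} : j ∈ oddIndices L ↔ 0 < j ∧ j < L + 4 ∧ Odd j := by
  simp only [oddIndices, Finset.mem_filter, Finset.mem_Icc]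
  constructor
  · rintro ⟨⟨h1, h2⟩, h3⟩
    exact ⟨by omega, by omega, h3⟩
  · rintro ⟨h1, h2, h3⟩
    exact ⟨⟨by omega, by omega⟩, h3⟩

theorem sum_oddIndices (L : ℕ) (f : ℕ → ℂ) :
    ∑ j ∈ oddIndices L, f j = ∑ i ∈ Finset.range ((L + 4) / 2), f (2 * i + 1) := by
  have h : oddIndices L = (Finset.range ((L + 4) / 2)).image (fun i => 2 * i + 1) := by
    ext j
    rw [mem_oddIndices, Finset.mem_image]
    constructor
    · rintro ⟨h1, h2, i, hi⟩
      exact ⟨i, Finset.mem_range.2 (by omega), hi.symm⟩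
    · rintro ⟨i, hi, rfl⟩
      rw [Finset.mem_range] at hi
      exact ⟨by omega, by omega, i, rfl⟩
  rw [h, Finset.sum_image fun a _ b _ hab => by omega]

/-- With w = ζ^m, the telescoped sum ends at exponent L + 4 for even L, where w^(L+4) = ±1 is its
own inverse, and at L + 3 for odd L, where w^(L+3) = (-1)^m w⁻¹. -/
theorem sum_oddIndices_pow (L : ℕ) {m : ℕ} (h0 : 0 < m) (h1 : m < L + 4) :
    ∑ j ∈ oddIndices L, ((zeta L ^ j) ^ m + ((zeta L ^ j) ^ m)⁻¹) =
      if Even L then 0 else -(-1) ^ m := by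
  have hw : zeta L ^ m ≠ 0 := pow_ne_zero _ (zeta_ne_zero L)
  have hne := sub_inv_ne_zero_of_sq_ne_one hw (zeta_pow_sq_ne_one L h0 h1)
  have hsum := sum_odd_pow (zeta L ^ m) hw ((L + 4) / 2)
  have hN : (zeta L ^ m) ^ (L + 4) = (-1) ^ m := by
    rw [← pow_mul, mul_comm, pow_mul, zeta_pow_eq_neg_one]
  have hinv : ((-1 : ℂ) ^ m)⁻¹ = (-1) ^ m := by
    rw [← inv_pow]
    norm_num
  have hcomm : ∀ j, (zeta L ^ j) ^ m = (zeta L ^ m) ^ j := fun j => pow_right_comm _ _ _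
  rw [sum_oddIndices]
  simp only [hcomm]
  refine mul_left_cancel₀ hne ?_
  rw [hsum]
  split_ifs with he
  · obtain ⟨c, rfl⟩ := he
    rw [show 2 * ((c + c + 4) / 2) = c + c + 4 by omega, hN, hinv]
    ring
  · obtain ⟨c, rfl⟩ := Nat.not_even_iff_odd.1 he
    have h2 : (zeta (2 * c + 1) ^ m) ^ (2 * ((2 * c + 1 + 4) / 2)) =
        (-1) ^ m * (zeta (2 * c + 1) ^ m)⁻¹ := by
      rw [← hN, show 2 * ((2 * c + 1 + 4) / 2) = 2 * c + 4 by omega,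
        show 2 * c + 1 + 4 = 2 * c + 4 + 1 by ring,
        pow_succ _ (2 * c + 4), mul_inv_cancel_right₀ hw]
    rw [h2, mul_inv, hinv, inv_inv]
    ring

/-- The increment from m to m + 1 is the sum of two successive cosine sums, which cancel for m ≥ 1;
only the jump from 0 to 1 remains. -/
theorem sum_modeCoeff (L : ℕ) {m : ℤ} (h0 : 0 < m) (h1 : m < (L + 4 : ℕ)) :
    ∑ j ∈ oddIndices L, modeCoeff ((L : ℂ) + 4) (zeta L ^ j) m = 1 := by
  have hN : ((L : ℂ) + 4) ≠ 0 := by exact_mod_cast (show L + 4 ≠ 0 by omega)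
  have hstep : ∀ k : ℕ, ∑ j ∈ oddIndices L, modeCoeff ((L : ℂ) + 4) (zeta L ^ j) (k + 1) =
      ∑ j ∈ oddIndices L, modeCoeff ((L : ℂ) + 4) (zeta L ^ j) k + 1 / ((L : ℂ) + 4) *
        (∑ j ∈ oddIndices L, ((zeta L ^ j) ^ (k + 1) + ((zeta L ^ j) ^ (k + 1))⁻¹) +
          ∑ j ∈ oddIndices L, ((zeta L ^ j) ^ k + ((zeta L ^ j) ^ k)⁻¹)) := by
    intro k
    rw [← Finset.sum_add_distrib, Finset.mul_sum, ← Finset.sum_add_distrib]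
    refine Finset.sum_congr rfl fun j hj => ?_
    obtain ⟨hj0, hj1, -⟩ := mem_oddIndices.1 hj
    rw [← modeCoeff_add_one_sub (pow_ne_zero _ (zeta_ne_zero L)) (zeta_pow_sq_ne_one L hj0 hj1)]
    ring
  have key : ∀ k : ℕ, k + 1 < L + 4 →
      ∑ j ∈ oddIndices L, modeCoeff ((L : ℂ) + 4) (zeta L ^ j) ((k : ℤ) + 1) = 1 := by
    intro k hk
    induction k with
    | zero =>
      -- The zeroth powers contribute twice the number of odd indices: L + 4 for even L, and L + 3
      -- for odd L, where the first powers supply the missing 1.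
      rw [hstep, sum_oddIndices_pow L (by omega) hk, sum_oddIndices L fun j =>
        (zeta L ^ j) ^ 0 + ((zeta L ^ j) ^ 0)⁻¹]
      simp only [Nat.cast_zero, modeCoeff_zero, pow_zero, inv_one, Finset.sum_const_zero,
        Finset.sum_const, Finset.card_range, nsmul_eq_mul]
      split_ifs with he
      · obtain ⟨c, rfl⟩ := he
        rw [show (c + c + 4) / 2 = c + 2 by omega]
        field_simp
        push_cast
        ring
      · obtain ⟨c, rfl⟩ := Nat.not_even_iff_odd.1 he
        rw [show (2 * c + 1 + 4) / 2 = c + 2 by omega]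
        field_simp
        push_cast
        ring
    | succ k ih =>
      rw [hstep, sum_oddIndices_pow L (by omega) hk, sum_oddIndices_pow L (by omega) (by omega)]
      push_cast
      rw [ih (by omega)]
      split_ifs
      · ring
      · ring
  have h2 := key (m - 1).toNat (by omega)
  rwa [Int.toNat_of_nonneg (by omega), sub_add_cancel] at h2

/-! ### The generating function -/

theorem coeff_inv_one_sub_C_mul_X (c : ℂ) (n : ℕ) :
    PowerSeries.coeff n ((1 - PowerSeries.C c * PowerSeries.X)⁻¹ : PowerSeries ℂ) = c ^ n := by
  have h : PowerSeries.mk (fun n => c ^ n) = (1 - PowerSeries.C c * PowerSeries.X)⁻¹ := by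
    rw [PowerSeries.eq_inv_iff_mul_eq_one (by simp)]
    ext k
    rw [mul_sub, mul_one, map_sub, mul_comm (PowerSeries.C c), ← mul_assoc,
      PowerSeries.coeff_mul_C]
    cases k with
    | zero => simp
    | succ k =>
      rw [PowerSeries.coeff_succ_mul_X]
      simp [PowerSeries.coeff_one, pow_succ]
  rw [← h, PowerSeries.coeff_mk]

theorem coeff_rootGF (L n : ℕ) : PowerSeries.coeff n (rootGF L) =
    1 / ((L : ℂ) + 4) ^ 2 * ∑ p ∈ (oddIndices L ×ˢ oddIndices L).filter (fun p => p.1 < p.2),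
      (zsum L p.2 - zsum L p.1) ^ 2 * (2 + zsum L p.1) * (2 + zsum L p.2) *
        (zsum L p.1 + zsum L p.2) ^ n := by
  have h : (Finset.Icc 1 (L + 3) ×ˢ Finset.Icc 1 (L + 3)).filter
      (fun p : ℕ × ℕ => p.1 < p.2 ∧ Odd p.1 ∧ Odd p.2) =
      (oddIndices L ×ˢ oddIndices L).filter (fun p => p.1 < p.2) := by
    ext p
    simp only [oddIndices, Finset.mem_filter, Finset.mem_product]
    tauto
  rw [rootGF, PowerSeries.coeff_C_mul, map_sum, h]
  simp only [PowerSeries.coeff_C_mul, coeff_inv_one_sub_C_mul_X]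

theorem sum_sum_eq_sum_lt (S : Finset ℕ) (F : ℕ → ℕ → ℂ) (h : ∀ j ∈ S, F j j = 0) :
    ∑ j ∈ S, ∑ k ∈ S, F j k =
      ∑ p ∈ (S ×ˢ S).filter (fun p => p.1 < p.2), (F p.1 p.2 + F p.2 p.1) := by
  rw [Finset.sum_filter, Finset.sum_product]
  have h1 : ∀ j ∈ S, ∀ k ∈ S, F j k =
      (if j < k then F j k else 0) + (if k < j then F j k else 0) := by
    intro j hj k hk
    rcases lt_trichotomy j k with hlt | rfl | hlt
    · simp [hlt, hlt.not_gt]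
    · simp [h j hj]
    · simp [hlt, hlt.not_gt]
  rw [Finset.sum_congr rfl fun j hj => Finset.sum_congr rfl fun k hk => h1 j hj k hk]
  simp only [Finset.sum_add_distrib]
  rw [Finset.sum_comm (f := fun j k => if k < j then F j k else 0)]
  simp only [← Finset.sum_add_distrib]
  refine Finset.sum_congr rfl fun j _ => Finset.sum_congr rfl fun k _ => ?_
  split_ifs <;> simp

theorem card_walk_corner (L n : ℕ) :
    (Nat.card (DiWalk (simpGraph 4 L) (corner 4 L 0) n) : ℂ) =
      PowerSeries.coeff n (rootGF L) := by
  have hN : ((L : ℂ) + 4) ≠ 0 := by exact_mod_cast (show L + 4 ≠ 0 by omega)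
  have hq : ∀ j, zeta L ^ j ≠ 0 := fun j => pow_ne_zero _ (zeta_ne_zero L)
  have hrec : ∀ j ∈ oddIndices L, ∀ m, modeCoeff ((L : ℂ) + 4) (zeta L ^ j) (m + 1) +
      modeCoeff ((L : ℂ) + 4) (zeta L ^ j) (m - 1) =
      zsum L j * modeCoeff ((L : ℂ) + 4) (zeta L ^ j) m := fun j _ m => modeCoeff_rec (hq j) m
  have hrefl : ∀ j ∈ oddIndices L, ∀ m, modeCoeff ((L : ℂ) + 4) (zeta L ^ j) ((L + 4 : ℕ) - m) =
      modeCoeff ((L : ℂ) + 4) (zeta L ^ j) m := fun j hj m => by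
    refine modeCoeff_refl (hq j) ?_ m
    rw [← pow_mul, mul_comm, pow_mul, zeta_pow_eq_neg_one, (mem_oddIndices.1 hj).2.2.neg_one_pow]
  have h1 : ∀ j ∈ oddIndices L,
      modeCoeff ((L : ℂ) + 4) (zeta L ^ j) 1 = (2 + zsum L j) / ((L : ℂ) + 4) := fun j hj => by
    obtain ⟨hj0, hj1, -⟩ := mem_oddIndices.1 hj
    exact modeCoeff_one (hq j) (zeta_pow_sq_ne_one L hj0 hj1)
  have h2 : ∀ j ∈ oddIndices L, modeCoeff ((L : ℂ) + 4) (zeta L ^ j) 2 =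
      zsum L j * ((2 + zsum L j) / ((L : ℂ) + 4)) := fun j hj => by
    have h := hrec j hj 1
    rwa [sub_self, modeCoeff_zero, add_zero, h1 j hj] at h
  have h3 : ∀ j ∈ oddIndices L, modeCoeff ((L : ℂ) + 4) (zeta L ^ j) 3 =
      (zsum L j ^ 2 - 1) * ((2 + zsum L j) / ((L : ℂ) + 4)) := fun j hj => by
    have h := hrec j hj 2
    rw [show (2 : ℤ) + 1 = 3 by norm_num, show (2 : ℤ) - 1 = 1 by norm_num, h1 j hj, h2 j hj] at h
    linear_combination h
  rw [card_walk_eq_pfaffianSum hrec (fun _ _ => modeCoeff_zero) hrefl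
    (fun m => sum_modeCoeff L), coeff_rootGF, Finset.mul_sum]
  have hc : (corner 4 L 0).1 1 = 0 ∧ (corner 4 L 0).1 2 = 0 ∧ (corner 4 L 0).1 3 = 0 := by
    simp [corner]
  rw [hc.1, hc.2.1, hc.2.2, pfaffianSum, Nat.cast_zero, zero_add, show (1 : ℤ) + 1 = 2 by norm_num,
    show (2 : ℤ) + 1 = 3 by norm_num, sum_sum_eq_sum_lt]
  · refine Finset.sum_congr rfl fun p hp => ?_
    rw [Finset.mem_filter, Finset.mem_product] at hp
    obtain ⟨⟨hj, hk⟩, -⟩ := hp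
    -- Up to the product of the two values at 1, the summand is 1 - z_j z_k + (z_j² - 1) = z_j² -
    -- z_j z_k; adding the one with j and k exchanged gives (z_k - z_j)².
    rw [h1 _ hj, h1 _ hk, h2 _ hj, h2 _ hk, h3 _ hj, h3 _ hk]
    field_simp
    ring
  · intro j hj
    rw [h1 j hj, h2 j hj, h3 j hj]
    ring

end Cylindric

open Cylindric
theorem mainTheorem12 (L : ℕ) (hL : 1 ≤ L) (n : ℕ) :
    ∃ N : ℕ,
      (N : ℂ) = PowerSeries.coeff n (rootGF L) ∧
      ENat.card (SCTInner (CylShape.rect 4 L) n) = N ∧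
      (∀ i : Fin 4, ENat.card (DiWalk (simpGraph 4 L) (corner 4 L i) n) = N) ∧
      (∀ i : Fin L, ENat.card (DiWalk (simpGraph L 4) (corner L 4 i) n) = N) ∧
      ENat.card (DiWalk (tasepGraph 4 L) (blockState 4 L) n) = N ∧
      ENat.card (MultiWalk (necklaceGraph 4 L)
        (Quotient.mk (rotSetoid 4 L) (blockState 4 L)) n) = N := by
  have : NeZero L := ⟨by omega⟩
  have hshape : ENat.card (DiWalk (shapeGraph 4 L) (CylShape.rect 4 L) n) =
      (Nat.card (DiWalk (simpGraph 4 L) (corner 4 L 0) n) : ℕ) := by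
    rw [(gapMap_isCovering 4 L ((0 : Fin 4) : ℕ)).card_eq, gapMap_rect, ENat.card_eq_coe_natCard]
  have htasep : ENat.card (DiWalk (tasepGraph 4 L) (blockState 4 L) n) =
      (Nat.card (DiWalk (simpGraph 4 L) (corner 4 L 0) n) : ℕ) := by
    rw [← particleMap_rect, ← (particleMap_isCovering 4 L).card_eq, hshape]
  refine ⟨_, card_walk_corner L n, ?_, fun i => ?_, fun i => ?_, htasep, ?_⟩
  · rw [card_sctInner, hshape]
  · rw [← gapMap_rect, ← (gapMap_isCovering 4 L i).card_eq, hshape]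
  · rw [← residueMap_rect, ← (residueMap_isCovering 4 L i).card_eq, hshape]
  · rw [← htasep, ENat.card_eq_coe_natCard, ENat.card_eq_coe_natCard, card_necklace_walk]
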